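/- Let $n\in\mathbb N$ and let $h:\mathbb C^n\to[0,\infty)$ be upper semicontinuous with $h(\lambda z)=|\lambda|h(z)$ for all $\lambda\in\mathbb C$, $z\in\mathbb C^n$. Let $D=D_h:=\{z\in\mathbb C^n: h(z)<1\}$ be the corresponding balanced domain, and let $L_h^2(D)=L^2(D)\cap\mathcal O(D)$ be the space of holomorphic functions on $D$ that are square integrable with respect to Lebesgue measure. Definitions. A domain is a nonempty connected open set. $D$ is an $L_h^2$-domain of holomorphy if there are no domains $D_0,D_1\subset\mathbb C^n$ with $\emptyset\ne D_0\subset D_1\cap D$ and $D_1\not\subset D$ such that for every $f\in L_h^2(D)$ there is $\tilde f\in\mathcal O(D_1)$ with $\tilde f=f$ on $D_0$. Every $f\in\mathcal O(D)$ has a unique expansion $f=\sum_{d\ge0}P_d$, locally uniformly convergent on $D$, where $P_d$ is a homogeneous polynomial of degree $d$ or $0$; put $h_f(z):=\limsup_{d\to\infty}|P_d(z)|^{1/d}$ for $z\in\mathbb C^n$. For an orthonormal basis $\{P_{d,j}: d\ge 0,\ j\in\mathcal J_d\}$ of the Hilbert space $L_h^2(D)$, where $P_{d,j}$ is a homogeneous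 polynomial of degree $d$ and each $\mathcal J_d$ is finite (possibly empty), put $h_{BK}(z):=\limsup_{d\to\infty}\big(\sum_{j\in\mathcal J_d}|P_{d,j}(z)|^2\big)^{1/(2d)}$ for $z\in\mathbb C^n$. For a function $u$ on $\mathbb C^n$, $u^*(z):=\limsup_{w\to z}u(w)$ (with $w=z$ allowed) denotes its upper semicontinuous regularization. Theorem. An orthonormal basis $\{P_{d,j}\}$ of $L_h^2(D)$ as above exists, and for every such basis the following conditions are equivalent: 1. $D$ is an $L_h^2$-domain of holomorphy; 2. there is $f\in L_h^2(D)$ such that $h(z)=h_f^*(z)$ for all $z\in\mathbb C^n$; 3. $h(z)=h_{BK}^*(z)$ for all $z\in\mathbb C^n$. -/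

import Mathlib

open MeasureTheory Filter Topology
open scoped ENNReal NNReal

noncomputable section

/-- A domain in `ℂⁿ`: a nonempty connected open set. -/
def IsComplexDomain {n : ℕ} (U : Set (Fin n → ℂ)) : Prop :=
  IsOpen U ∧ IsConnected U

/-- `h : ℂⁿ → [0, ∞)` is upper semicontinuous and `h (c z) = |c| h z`. -/
structure IsBalancedGauge {n : ℕ} (h : (Fin n → ℂ) → ℝ≥0) : Prop where
  upperSemicontinuous : UpperSemicontinuous h
  homogeneous : ∀ (c : ℂ) (z : Fin n → ℂ), h (c • z) = ‖c‖₊ * h z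

/-- The balanced domain `D_h = {z ∈ ℂⁿ : h z < 1}`. -/
def balancedDomain {n : ℕ} (h : (Fin n → ℂ) → ℝ≥0) : Set (Fin n → ℂ) :=
  {z | h z < 1}

/-- The square integrable holomorphic functions on `D` (Lebesgue measure on `ℂⁿ`); only the
values on `D` matter. -/
def L2Hol {n : ℕ} (D : Set (Fin n → ℂ)) : Set ((Fin n → ℂ) → ℂ) :=
  {f | DifferentiableOn ℂ f D ∧ MemLp f 2 (volume.restrict D)}

/-- `D` is an `F`-domain of holomorphy: there are no domains `D₀`, `D₁` with
`∅ ≠ D₀ ⊆ D₁ ∩ D` and `D₁ ⊄ D` such that every `f ∈ F` agrees on `D₀` with a function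
holomorphic on `D₁`. -/
def IsDomainOfHolomorphyFor {n : ℕ} (F : Set ((Fin n → ℂ) → ℂ)) (D : Set (Fin n → ℂ)) : Prop :=
  IsComplexDomain D ∧
    ¬ ∃ D₀ D₁ : Set (Fin n → ℂ), IsComplexDomain D₀ ∧ IsComplexDomain D₁ ∧
      D₀ ⊆ D₁ ∩ D ∧ ¬ D₁ ⊆ D ∧
      ∀ f ∈ F, ∃ g : (Fin n → ℂ) → ℂ, DifferentiableOn ℂ g D₁ ∧ Set.EqOn g f D₀

/-- The Bergman space `L²(D) ∩ 𝒪(D)` as a subspace of the Hilbert space `L²(D)`. -/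
def bergmanSpace {n : ℕ} (D : Set (Fin n → ℂ)) :
    Submodule ℂ (Lp ℂ 2 ((volume : Measure (Fin n → ℂ)).restrict D)) where
  carrier := {F | ∃ f ∈ L2Hol D, F =ᵐ[volume.restrict D] f}
  zero_mem' := ⟨0, ⟨differentiableOn_const 0, MemLp.zero⟩, Lp.coeFn_zero _ _ _⟩
  add_mem' := by
    rintro F G ⟨f, hf, hF⟩ ⟨g, hg, hG⟩
    exact ⟨f + g, ⟨hf.1.add hg.1, hf.2.add hg.2⟩, (Lp.coeFn_add F G).trans (hF.add hG)⟩
  smul_mem' := by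
    rintro c F ⟨f, hf, hF⟩
    exact ⟨c • f, ⟨hf.1.const_smul c, hf.2.const_smul c⟩,
      (Lp.coeFn_smul c F).trans (hF.const_smul c)⟩

/-- `f = ∑ P_d` locally uniformly on `D`, where `P_d` is a homogeneous polynomial of degree `d`
or `0`. -/
def IsHomogeneousExpansion {n : ℕ} (D : Set (Fin n → ℂ)) (f : (Fin n → ℂ) → ℂ)
    (P : ℕ → MvPolynomial (Fin n) ℂ) : Prop :=
  (∀ d, (P d).IsHomogeneous d) ∧
    TendstoLocallyUniformlyOn
      (fun (N : ℕ) (z : Fin n → ℂ) => ∑ d ∈ Finset.range N, MvPolynomial.eval z (P d)) f atTop D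

/-- `Q d j`, for `d = 0, 1, …` and `j < k d`, is an orthonormal (Hilbert) basis of the Bergman
space of `D`, and each `Q d j` is a homogeneous polynomial of degree `d`. -/
def IsHomogeneousOrthonormalBasis {n : ℕ} (D : Set (Fin n → ℂ)) (k : ℕ → ℕ)
    (Q : (d : ℕ) → Fin (k d) → MvPolynomial (Fin n) ℂ) : Prop :=
  (∀ d j, (Q d j).IsHomogeneous d) ∧
    ∃ b : HilbertBasis (Σ d, Fin (k d)) ℂ (bergmanSpace D),
      ∀ d j, (b ⟨d, j⟩ : Lp ℂ 2 ((volume : Measure (Fin n → ℂ)).restrict D))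
        =ᵐ[volume.restrict D] fun z => MvPolynomial.eval z (Q d j)

/-- `limsup_d |P_d(z)|^{1/d}`: this is `h_f z` when `f = ∑ P_d`. -/
def expansionRadiusFn {n : ℕ} (P : ℕ → MvPolynomial (Fin n) ℂ) (z : Fin n → ℂ) : ℝ≥0∞ :=
  limsup (fun d : ℕ => ‖MvPolynomial.eval z (P d)‖ₑ ^ (1 / (d : ℝ))) atTop

/-- `h_BK z = limsup_d (∑_j |Q_{d,j}(z)|²)^{1/(2d)}`. -/
def bergmanRadiusFn {n : ℕ} (k : ℕ → ℕ) (Q : (d : ℕ) → Fin (k d) → MvPolynomial (Fin n) ℂ)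
    (z : Fin n → ℂ) : ℝ≥0∞ :=
  limsup (fun d : ℕ => (∑ j, ‖MvPolynomial.eval z (Q d j)‖ₑ ^ 2) ^ (1 / (2 * (d : ℝ)))) atTop

/-- The upper semicontinuous regularization `u*(z) = limsup_{w → z} u(w)` (`w = z` allowed). -/
def uscRegularization {n : ℕ} (u : (Fin n → ℂ) → ℝ≥0∞) (z : Fin n → ℂ) : ℝ≥0∞ :=
  limsup u (𝓝 z)

end

/-! Write `K_d(z) = ∑_j |P_{d,j}(z)|²`. The proof rests on reading `K_d(z)` as a squared operator
norm: the vector `∑_j conj(P_{d,j}(z)) P_{d,j}` shows that a functional of norm at most `C` which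
evaluates the degree-`d` basis polynomials at `z` forces `K_d(z) ≤ C²` (`homogeneousKernel_le_sq`).
A bound that does not depend on `d` disappears under the `2d`-th root, so `h_BK(z) ≤ 1`. Point
evaluations are bounded on `D`, so by homogeneity `h_BK ≤ h`, and then `h_BK* ≤ h` because `h` is
upper semicontinuous. On the other side, Cauchy–Schwarz and Bessel give `h_f ≤ h_BK` for every `f`
in the space.

The basis exists because `D` is invariant under rotations `z ↦ e^{iθ}z`: homogeneous polynomials of
different degrees are orthogonal, and Cauchy's formula on circles shows that the homogeneous
components of a square integrable function are square integrable. A function orthogonal to all of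
them has zero components and so vanishes.

1 → 3: if `h_BK*(z) < h(z)` for some `z`, then `{h_BK* < 1}` is a strictly larger domain. Hartogs'
lemma (`exists_forall_enorm_le_pow_of_limsup_le`) makes the expansion of every `f` converge there,
so all `f` extend at once. Hartogs' lemma itself comes from the sub-mean value property of
`|f_d|^{1/d}` on balls and the reverse Fatou lemma.

3 → 1: if every `f` extends to `D₁`, the closed graph theorem makes evaluation of the extension at a
point of `D₁` a bounded functional (`exists_bounded_extension_functional`). Polynomials extend as
themselves, so `h_BK ≤ 1` on `D₁`; hence `h ≤ 1` on the open set `D₁`, and dilating by a factor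
slightly above `1` gives `h < 1`.

2 → 3 is the chain `h = h_f* ≤ h_BK* ≤ h`. 3 → 2 is Baire category: a generic element of the space
satisfies `h_f* ≥ h_BK*` (`exists_uscRegularization_bergmanRadiusFn_le`). -/

/-! ### Holomorphic maps on complex normed spaces: Cauchy estimates, limits, identity theorem. -/

section HolomorphicNormedSpace

variable {E F : Type*} [NormedAddCommGroup E] [NormedSpace ℂ E]
  [NormedAddCommGroup F] [NormedSpace ℂ F]

/-- Cauchy's estimate for the Fréchet derivative. -/
lemma norm_fderiv_le_of_norm_le_on_ball {f : E → F} {w : E} {r M : ℝ} (hr : 0 < r)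
    (hd : DifferentiableOn ℂ f (Metric.ball w r)) (hM : ∀ z ∈ Metric.ball w r, ‖f z‖ ≤ M) :
    ‖fderiv ℂ f w‖ ≤ 2 * M / r := by
  refine Complex.norm_fderiv_le_div_of_mapsTo_ball hd (fun z hz => ?_) hr
  rw [Metric.mem_closedBall, dist_eq_norm]
  have h1 := hM z hz
  have h2 := hM w (Metric.mem_ball_self hr)
  linarith [norm_sub_le (f z) (f w)]

/-- A uniform limit of holomorphic functions on a ball is differentiable at the center. -/
lemma differentiableAt_of_tendstoUniformlyOn_ball [CompleteSpace F] {f : ℕ → E → F} {g : E → F}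
    {x : E} {r : ℝ} (hr : 0 < r) (hf : ∀ k, DifferentiableOn ℂ (f k) (Metric.ball x r))
    (hfg : TendstoUniformlyOn f g atTop (Metric.ball x r)) : DifferentiableAt ℂ g x := by
  have hsub : ∀ y ∈ Metric.ball x (r / 2), Metric.ball y (r / 2) ⊆ Metric.ball x r :=
    fun y hy => Metric.ball_subset_ball' (by rw [Metric.mem_ball] at hy; linarith)
  have hmem : ∀ y ∈ Metric.ball x (r / 2), y ∈ Metric.ball x r :=
    fun y hy => hsub y hy (Metric.mem_ball_self (by positivity))
  have hda : ∀ k, ∀ y ∈ Metric.ball x r, DifferentiableAt ℂ (f k) y := fun k y hy =>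
    (hf k).differentiableAt (Metric.isOpen_ball.mem_nhds hy)
  have hC : UniformCauchySeqOn (fun k => fderiv ℂ (f k)) atTop (Metric.ball x (r / 2)) := by
    have h0 := hfg.uniformCauchySeqOn
    rw [Metric.uniformCauchySeqOn_iff] at h0 ⊢
    intro ε hε
    -- Cauchy's estimate on balls of radius `r / 2` turns this bound into `2 * (ε * r / 8) / (r / 2)
    -- = ε / 2`.
    obtain ⟨N, hN⟩ := h0 (ε * r / 8) (by positivity)
    refine ⟨N, fun m hm k hk y hy => ?_⟩
    rw [dist_eq_norm, ← fderiv_sub (hda m y (hmem y hy)) (hda k y (hmem y hy))]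
    refine (norm_fderiv_le_of_norm_le_on_ball (half_pos hr) (M := ε * r / 8)
      (((hf m).sub (hf k)).mono (hsub y hy)) fun z hz => ?_).trans_lt ?_
    · have := hN m hm k hk z (hsub y hy hz)
      rw [dist_eq_norm] at this
      exact this.le
    · have : 2 * (ε * r / 8) / (r / 2) = ε / 2 := by field_simp; norm_num
      rw [this]; linarith
  have hlim : ∀ y ∈ Metric.ball x (r / 2),
      ∃ L, Tendsto (fun k => fderiv ℂ (f k) y) atTop (𝓝 L) := fun y hy =>
    cauchySeq_tendsto_of_complete (hC.cauchySeq hy)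
  choose! g' hg' using hlim
  exact (hasFDerivAt_of_tendstoLocallyUniformlyOn Metric.isOpen_ball
    (hC.tendstoUniformlyOn_of_tendsto hg').tendstoLocallyUniformlyOn
    (fun k y hy => (hda k y (hmem y hy)).hasFDerivAt)
    (fun y hy => hfg.tendsto_at (hmem y hy)) (Metric.mem_ball_self (half_pos hr))).differentiableAt

/-- A locally uniform limit of holomorphic functions is holomorphic. -/
lemma differentiableOn_of_tendstoLocallyUniformlyOn [ProperSpace E] [CompleteSpace F]
    {f : ℕ → E → F} {g : E → F} {U : Set E} (hU : IsOpen U) (hf : ∀ k, DifferentiableOn ℂ (f k) U)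
    (hfg : TendstoLocallyUniformlyOn f g atTop U) : DifferentiableOn ℂ g U := by
  intro x hx
  obtain ⟨r, hr, hrU⟩ := Metric.nhds_basis_closedBall.mem_iff.1 (hU.mem_nhds hx)
  have hb : Metric.ball x r ⊆ U := Metric.ball_subset_closedBall.trans hrU
  refine (differentiableAt_of_tendstoUniformlyOn_ball hr (fun k => (hf k).mono hb)
    (TendstoUniformlyOn.mono ?_ Metric.ball_subset_closedBall)).differentiableWithinAt
  exact (tendstoLocallyUniformlyOn_iff_tendstoUniformlyOn_of_compact
    (isCompact_closedBall x r)).1 (hfg.mono hrU)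

/-- Quadratic Taylor estimate for bounded holomorphic functions. -/
lemma norm_sub_sub_fderiv_le_of_norm_le_on_ball {f : E → F} {w u : E} {r M : ℝ} (hr : 0 < r)
    (hd : DifferentiableOn ℂ f (Metric.ball w r)) (hM : ∀ z ∈ Metric.ball w r, ‖f z‖ ≤ M)
    (hu : ‖u‖ < r) : ‖f (w + u) - f w - fderiv ℂ f w u‖ ≤ 4 * M * (‖u‖ / r) ^ 2 := by
  have hda : DifferentiableAt ℂ f w := hd.differentiableAt (Metric.ball_mem_nhds w hr)
  -- A Schwarz lemma for `f` minus its differential at `w`: it differs from its value at `w` by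
  -- `o(‖z - w‖)`, with distance at most `4 * M` on the ball, so the decay is quadratic.
  have hdist := Complex.dist_le_mul_div_pow_of_mapsTo_ball_of_isLittleO
    (f := fun z => f z - fderiv ℂ f w (z - w)) (c := w) (z := w + u) (R₁ := r) (R₂ := 4 * M)
    (n := 1) ?_ ?_ ?_ ?_
  · rw [dist_eq_norm, dist_eq_norm] at hdist
    simpa [sub_right_comm] using hdist
  · exact hd.sub (by fun_prop)
  · intro z hz
    rw [Metric.mem_closedBall, dist_eq_norm]
    have h1 := hM z hz
    have h2 := hM w (Metric.mem_ball_self hr)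
    have h3 := norm_fderiv_le_of_norm_le_on_ball hr hd hM
    have h4 : ‖fderiv ℂ f w (z - w)‖ ≤ 2 * M := by
      refine ((fderiv ℂ f w).le_opNorm _).trans ?_
      rw [Metric.mem_ball, dist_eq_norm] at hz
      calc _ ≤ 2 * M / r * r := by gcongr; exact (norm_nonneg _).trans h3
        _ = 2 * M := by field_simp
    simp only [sub_self, map_zero, sub_zero]
    calc _ ≤ ‖f z‖ + ‖fderiv ℂ f w (z - w)‖ + ‖f w‖ :=
          (norm_sub_le _ _).trans (by gcongr; exact norm_sub_le _ _)
      _ ≤ 4 * M := by linarith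
  · have := hda.hasFDerivAt.isLittleO
    simp only [pow_one]
    refine Asymptotics.IsLittleO.congr' (this.norm_right) ?_ EventuallyEq.rfl
    filter_upwards with z
    simp [sub_right_comm]
  · simpa using hu

/-- Directional derivatives of a holomorphic function are holomorphic. -/
lemma differentiableOn_fderiv_apply [ProperSpace E] [CompleteSpace F] {f : E → F} {U : Set E}
    (hU : IsOpen U) (hf : DifferentiableOn ℂ f U) (v : E) :
    DifferentiableOn ℂ (fun z => fderiv ℂ f z v) U := by
  intro x hx
  obtain ⟨r, hr, hrU⟩ := Metric.nhds_basis_closedBall.mem_iff.1 (hU.mem_nhds hx)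
  obtain ⟨M, hM⟩ := (isCompact_closedBall x r).exists_bound_of_continuousOn
    (hf.continuousOn.mono hrU)
  have hM0 : 0 ≤ M := (norm_nonneg _).trans (hM x (Metric.mem_closedBall_self hr.le))
  have hsub : ∀ y ∈ Metric.ball x (r / 2), Metric.ball y (r / 2) ⊆ Metric.ball x r :=
    fun y hy => Metric.ball_subset_ball' (by rw [Metric.mem_ball] at hy; linarith)
  have hb : Metric.ball x r ⊆ U := Metric.ball_subset_closedBall.trans hrU
  -- The directional derivative is a uniform limit of difference quotients with steps `s k = 1 / (k
  -- + K + 1)`; the shift by `K` keeps `s k • v` shorter than `r / 2`.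
  obtain ⟨K, hK⟩ := exists_nat_gt (2 * ‖v‖ / r)
  set s : ℕ → ℂ := fun k => ((k + K + 1 : ℕ) : ℂ)⁻¹ with hs
  have hs0 : ∀ k, s k ≠ 0 := fun k => inv_ne_zero (Nat.cast_ne_zero.2 (by omega))
  have hsn : ∀ k, ‖s k‖ = ((k + K + 1 : ℕ) : ℝ)⁻¹ := fun k => by simp only [hs, norm_inv, Complex.norm_natCast]
  have hsv : ∀ k, ‖s k • v‖ < r / 2 := fun k => by
    rw [norm_smul, hsn, inv_mul_lt_iff₀ (by positivity)]
    rw [div_lt_iff₀ hr] at hK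
    have : (K : ℝ) ≤ ((k + K + 1 : ℕ) : ℝ) := by push_cast; linarith [(Nat.cast_nonneg k : (0:ℝ) ≤ k)]
    nlinarith
  refine (differentiableAt_of_tendstoUniformlyOn_ball (r := r / 2) (half_pos hr)
    (f := fun k z => (s k)⁻¹ • (f (z + s k • v) - f z)) (fun k => ?_) ?_).differentiableWithinAt
  · refine DifferentiableOn.const_smul (DifferentiableOn.sub ?_ (hf.mono fun y hy =>
      hb (hsub y hy (Metric.mem_ball_self (half_pos hr))))) _
    refine hf.comp (by fun_prop) fun y hy => hb (hsub y hy ?_)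
    simpa using hsv k
  · rw [Metric.tendstoUniformlyOn_iff]
    intro ε hε
    have hlim : Tendsto (fun k => ‖s k‖ * (4 * M * (‖v‖ / (r / 2)) ^ 2)) atTop (𝓝 0) := by
      refine Tendsto.zero_mul_isBoundedUnder_le ?_ isBoundedUnder_const
      simp only [hsn]
      refine tendsto_inv_atTop_zero.comp (tendsto_natCast_atTop_atTop.comp ?_)
      exact tendsto_atTop_mono (fun k => show k ≤ k + K + 1 by omega) tendsto_id
    filter_upwards [hlim.eventually_lt_const hε] with k hk y hy
    refine lt_of_le_of_lt ?_ hk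
    have hT := norm_sub_sub_fderiv_le_of_norm_le_on_ball (half_pos hr) (M := M) (u := s k • v)
      (hf.mono ((hsub y hy).trans hb))
      (fun z hz => hM z (Metric.ball_subset_closedBall (hsub y hy hz))) (hsv k)
    rw [dist_comm, dist_eq_norm]
    have e : (s k)⁻¹ • (f (y + s k • v) - f y) - fderiv ℂ f y v
        = (s k)⁻¹ • (f (y + s k • v) - f y - fderiv ℂ f y (s k • v)) := by
      rw [smul_sub _ (f (y + s k • v) - f y), map_smul, inv_smul_smul₀ (hs0 k)]
    rw [e, norm_smul, norm_inv, inv_mul_le_iff₀ (norm_pos_iff.2 (hs0 k))]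
    refine hT.trans (le_of_eq ?_)
    rw [norm_smul]; ring

/-- The identity theorem on connected open sets. -/
lemma eqOn_of_isPreconnected_of_eventuallyEq [CompleteSpace F] {f g : E → F} {U : Set E}
    (hU : IsOpen U) (hc : IsPreconnected U) (hf : DifferentiableOn ℂ f U)
    (hg : DifferentiableOn ℂ g U) {z₀ : E} (h₀ : z₀ ∈ U) (hfg : f =ᶠ[𝓝 z₀] g) :
    Set.EqOn f g U := by
  have hsub : U ⊆ {z | f =ᶠ[𝓝 z] g} := by
    -- The set of points near which `f = g` is open; it is also closed in `U`, because within a ball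
    -- around a limit point any `w` is reached from a good point `b` along the complex line through
    -- `b` and `w`.
    refine hc.subset_of_closure_inter_subset isOpen_setOfPred_eventually_nhds ⟨z₀, h₀, hfg⟩ ?_
    rintro a ⟨ha, haU⟩
    obtain ⟨r, hr, hrU⟩ := Metric.isOpen_iff.1 hU a haU
    obtain ⟨b, hb, hab⟩ := Metric.mem_closure_iff.1 ha r hr
    filter_upwards [Metric.ball_mem_nhds a hr] with w hw
    have hline : AnalyticOnNhd ℂ (fun t : ℂ => f (b + t • (w - b)) - g (b + t • (w - b)))
        ((fun t : ℂ => b + t • (w - b)) ⁻¹' (Metric.ball a r)) := by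
      refine DifferentiableOn.analyticOnNhd ?_ (Metric.isOpen_ball.preimage (by fun_prop))
      exact (hf.sub hg).comp (by fun_prop) fun t ht => hrU ht
    have hconv : IsPreconnected ((fun t : ℂ => b + t • (w - b)) ⁻¹' (Metric.ball a r)) := by
      refine Convex.isPreconnected fun t ht u hu α β hα hβ hαβ => ?_
      simp only [Set.mem_preimage, Metric.mem_ball, dist_eq_norm] at ht hu ⊢
      have e : b + (α • t + β • u) • (w - b) - a
          = (α : ℂ) • (b + t • (w - b) - a) + (β : ℂ) • (b + u • (w - b) - a) := by
        have : (β : ℂ) = 1 - α := by rw [← Complex.ofReal_one, ← hαβ]; push_cast; ring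
        rw [Complex.real_smul, Complex.real_smul, this]
        module
      rw [e]
      refine (norm_add_le _ _).trans_lt ?_
      rw [norm_smul, norm_smul, Complex.norm_of_nonneg hα, Complex.norm_of_nonneg hβ]
      rcases hα.eq_or_lt with rfl | hα
      · have : β = 1 := by linarith
        simpa [this] using hu
      · calc _ < α * r + β * r :=
              add_lt_add_of_lt_of_le (by gcongr) (by gcongr)
          _ = r := by rw [← add_mul, hαβ, one_mul]
    have hev : (fun t : ℂ => f (b + t • (w - b)) - g (b + t • (w - b))) =ᶠ[𝓝 0] 0 := by
      have hct : Tendsto (fun t : ℂ => b + t • (w - b)) (𝓝 0) (𝓝 b) := by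
        have : Continuous (fun t : ℂ => b + t • (w - b)) := by fun_prop
        simpa using this.tendsto 0
      filter_upwards [hct.eventually hb] with t ht
      simp [ht]
    have h0 : (0 : ℂ) ∈ (fun t : ℂ => b + t • (w - b)) ⁻¹' (Metric.ball a r) := by
      simpa [dist_comm] using hab
    have h1 : (1 : ℂ) ∈ (fun t : ℂ => b + t • (w - b)) ⁻¹' (Metric.ball a r) := by
      simpa using hw
    have := hline.eqOn_zero_of_preconnected_of_eventuallyEq_zero hconv h0 hev h1
    simpa [sub_eq_zero] using this
  exact fun z hz => (hsub hz).self_of_nhds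

end HolomorphicNormedSpace

/-! ### Homogeneous Taylor components. -/

/-- The Taylor coefficients at `0` of a holomorphic function along complex lines are given by
homogeneous polynomials. -/
lemma exists_isHomogeneous_eval_eq_iteratedDeriv {n : ℕ} {D : Set (Fin n → ℂ)} (hD : IsOpen D)
    (h0 : (0 : Fin n → ℂ) ∈ D) (d : ℕ) {f : (Fin n → ℂ) → ℂ} (hf : DifferentiableOn ℂ f D) :
    ∃ P : MvPolynomial (Fin n) ℂ, P.IsHomogeneous d ∧
      ∀ z, iteratedDeriv d (fun t : ℂ => f (t • z)) 0 = MvPolynomial.eval z P := by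
  induction d generalizing f with
  | zero => exact ⟨MvPolynomial.C (f 0), MvPolynomial.isHomogeneous_C _ _, fun z => by simp⟩
  | succ d ih =>
    -- The induction runs on the partial derivatives, through `d/dt f(tz) = ∑ i, z i * ∂ᵢf(tz)`.
    choose P hP hPe using fun i : Fin n =>
      ih (differentiableOn_fderiv_apply hD hf (Pi.single i 1))
    refine ⟨∑ i, MvPolynomial.X i * P i, ?_, fun z => ?_⟩
    · refine MvPolynomial.IsHomogeneous.sum _ _ _ fun i _ => ?_
      rw [add_comm]
      exact (MvPolynomial.isHomogeneous_X ℂ i).mul (hP i)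
    · have hopen : IsOpen ((fun t : ℂ => t • z) ⁻¹' D) := hD.preimage (by fun_prop)
      have hmem : (0 : ℂ) ∈ (fun t : ℂ => t • z) ⁻¹' D := by simpa using h0
      have hderiv : deriv (fun t : ℂ => f (t • z)) =ᶠ[𝓝 0]
          fun t => ∑ i, z i * fderiv ℂ f (t • z) (Pi.single i 1) := by
        filter_upwards [hopen.mem_nhds hmem] with t ht
        have h1 : HasFDerivAt f (fderiv ℂ f (t • z)) (t • z) :=
          (hf.differentiableAt (hD.mem_nhds ht)).hasFDerivAt
        have h2 : HasDerivAt (fun t : ℂ => t • z) z t := by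
          simpa using (hasDerivAt_id t).smul_const z
        have h3 := (h1.comp_hasDerivAt t h2).deriv
        rw [Function.comp_def] at h3
        rw [h3]
        nth_rw 2 [← Finset.univ_sum_single z]
        rw [map_sum]
        refine Finset.sum_congr rfl fun i _ => ?_
        rw [← smul_eq_mul, ← map_smul, ← Pi.single_smul, smul_eq_mul, mul_one]
      have hcd : ∀ i, ContDiffAt ℂ d (fun t : ℂ => fderiv ℂ f (t • z) (Pi.single i 1)) 0 :=
        fun i => (DifferentiableOn.analyticAt (s := (fun t : ℂ => t • z) ⁻¹' D)
          ((differentiableOn_fderiv_apply hD hf (Pi.single i 1)).comp (by fun_prop)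
            fun t ht => ht) (hopen.mem_nhds hmem)).contDiffAt
      rw [iteratedDeriv_succ', hderiv.iteratedDeriv_eq,
        iteratedDeriv_fun_sum fun i _ => contDiffAt_const.mul (hcd i), map_sum]
      refine Finset.sum_congr rfl fun i _ => ?_
      rw [iteratedDeriv_const_mul_field, hPe, map_mul, MvPolynomial.eval_X]

/-! ### Sub-mean value inequalities and Hartogs' lemma. -/

/-- Sub-mean value property of `|φ|^α` on the unit circle, in terms of circle averages. -/
lemma rpow_norm_le_circleAverage {φ : ℂ → ℂ} (hφ : AnalyticOnNhd ℂ φ (Metric.closedBall 0 1))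
    {α : ℝ} (hα : 0 < α) : ‖φ 0‖ ^ α ≤ Real.circleAverage (fun t => ‖φ t‖ ^ α) 0 1 := by
  rcases eq_or_ne (φ 0) 0 with h0 | h0
  · rw [h0, norm_zero, Real.zero_rpow hα.ne']
    exact Real.circleAverage_nonneg_of_nonneg fun x _ => by positivity
  have hm : 0 < ‖φ 0‖ := norm_pos_iff.2 h0
  have hlog : Real.log ‖φ 0‖ ≤ Real.circleAverage (fun t => Real.log ‖φ t‖) 0 1 := by
    -- Jensen's formula: the zeros of `φ` in the disc contribute nonnegative terms.
    rw [AnalyticOnNhd.circleAverage_log_norm one_ne_zero (by simpa using hφ) h0]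
    refine le_add_of_nonneg_left (finsum_nonneg fun u => ?_)
    by_cases hu : u ∈ Metric.closedBall (0 : ℂ) |1|
    · refine mul_nonneg ?_ ?_
      · exact_mod_cast (MeromorphicOn.AnalyticOnNhd.divisor_nonneg (by simpa using hφ)) u
      · rcases eq_or_ne u 0 with rfl | hu0
        · simp
        · refine Real.log_nonneg ?_
          rw [zero_sub, norm_neg, one_mul]
          refine (one_le_inv₀ (norm_pos_iff.2 hu0)).2 (by simpa using hu)
    · rw [Function.locallyFinsuppWithin.apply_eq_zero_of_notMem _ hu]; simp
  have hint : CircleIntegrable (fun t => Real.log ‖φ t‖) 0 1 :=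
    MeromorphicOn.circleIntegrable_log_norm fun z hz =>
      (hφ z (by simpa using Metric.sphere_subset_closedBall hz)).meromorphicAt
  have hcont : ContinuousOn (fun t => ‖φ t‖ ^ α) (Metric.sphere 0 1) := by
    refine ContinuousOn.rpow_const ?_ fun _ _ => Or.inr hα.le
    exact (hφ.continuousOn.mono Metric.sphere_subset_closedBall).norm
  -- At a zero of `φ` the convention `Real.log 0 = 0` makes `exp (α * log ‖φ t‖)` equal to `1`
  -- instead of `0`; such points are discrete and do not affect the average.
  have hne : {z | φ z ≠ 0} ∈ codiscreteWithin (Metric.sphere (0 : ℂ) |1|) := by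
    refine codiscreteWithin_mono (U := Metric.closedBall 0 1) ?_
      (hφ.preimage_zero_mem_codiscreteWithin h0 (by simp)
        ((convex_closedBall (0 : ℂ) 1).isConnected ⟨0, by simp⟩))
    rw [abs_one]
    exact Metric.sphere_subset_closedBall
  have hae : (fun t => Real.exp (α * Real.log ‖φ t‖))
      =ᶠ[codiscreteWithin (Metric.sphere (0 : ℂ) |1|)] fun t => ‖φ t‖ ^ α := by
    filter_upwards [hne] with t ht
    rw [Real.rpow_def_of_pos (norm_pos_iff.2 ht), mul_comm]
  rw [← Real.circleAverage_congr_codiscreteWithin hae one_ne_zero]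
  have hint2 : CircleIntegrable (fun t => Real.exp (α * Real.log ‖φ t‖)) 0 1 :=
    CircleIntegrable.congr_codiscreteWithin hae.symm (hcont.circleIntegrable zero_le_one)
  have hint3 : CircleIntegrable (fun t => ‖φ 0‖ ^ α * α * Real.log ‖φ t‖) 0 1 := by
    simpa [Pi.smul_def, smul_eq_mul] using hint.const_smul (a := ‖φ 0‖ ^ α * α)
  have haff : CircleIntegrable (fun t => ‖φ 0‖ ^ α * (1 - α * Real.log ‖φ 0‖)
      + ‖φ 0‖ ^ α * α * Real.log ‖φ t‖) 0 1 :=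
    (circleIntegrable_const _ 0 1).add hint3
  -- Jensen's inequality for `exp`, done by hand with the tangent line at `α * log ‖φ 0‖`.
  calc ‖φ 0‖ ^ α = ‖φ 0‖ ^ α * (1 - α * Real.log ‖φ 0‖)
        + ‖φ 0‖ ^ α * α * Real.log ‖φ 0‖ := by ring
    _ ≤ ‖φ 0‖ ^ α * (1 - α * Real.log ‖φ 0‖)
        + ‖φ 0‖ ^ α * α * Real.circleAverage (fun t => Real.log ‖φ t‖) 0 1 := by gcongr
    _ = Real.circleAverage (fun t => ‖φ 0‖ ^ α * (1 - α * Real.log ‖φ 0‖)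
        + ‖φ 0‖ ^ α * α * Real.log ‖φ t‖) 0 1 := by
      rw [Real.circleAverage_fun_add (circleIntegrable_const _ 0 1) hint3,
        Real.circleAverage_const]
      congr 1
      exact (Real.circleAverage_fun_smul (a := ‖φ 0‖ ^ α * α)).symm
    _ ≤ _ := by
      refine Real.circleAverage_mono haff hint2 fun t _ => ?_
      have h1 : ‖φ 0‖ ^ α = Real.exp (α * Real.log ‖φ 0‖) := by
        rw [Real.rpow_def_of_pos hm, mul_comm]
      have h2 : Real.exp (α * Real.log ‖φ t‖) = Real.exp (α * Real.log ‖φ 0‖) *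
          Real.exp (α * Real.log ‖φ t‖ - α * Real.log ‖φ 0‖) := by
        rw [← Real.exp_add]; ring_nf
      rw [h2, h1]
      have h3 := Real.add_one_le_exp (α * Real.log ‖φ t‖ - α * Real.log ‖φ 0‖)
      have h4 := Real.exp_pos (α * Real.log ‖φ 0‖)
      nlinarith

/-- Sub-mean value property of `|φ|^α` on the unit circle, for the Lebesgue integral. -/
lemma enorm_rpow_le_lintegral_circleMap {φ : ℂ → ℂ}
    (hφ : AnalyticOnNhd ℂ φ (Metric.closedBall 0 1)) {α : ℝ} (hα : 0 < α) :
    ‖φ 0‖ₑ ^ α ≤ (ENNReal.ofReal (2 * Real.pi))⁻¹ *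
      ∫⁻ θ in Set.Ioc 0 (2 * Real.pi), ‖φ (circleMap 0 1 θ)‖ₑ ^ α := by
  have hpi : (0 : ℝ) < 2 * Real.pi := Real.two_pi_pos
  have hcont : Continuous fun θ => ‖φ (circleMap 0 1 θ)‖ ^ α := by
    refine Continuous.rpow_const (Continuous.norm ?_) fun _ => Or.inr hα.le
    refine hφ.continuousOn.comp_continuous (continuous_circleMap 0 1) fun θ => ?_
    exact Metric.sphere_subset_closedBall (circleMap_mem_sphere 0 zero_le_one θ)
  have henorm : ∀ z : ℂ, ‖z‖ₑ ^ α = ENNReal.ofReal (‖z‖ ^ α) := fun z => by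
    rw [← ofReal_norm, ENNReal.ofReal_rpow_of_nonneg (norm_nonneg _) hα.le]
  simp only [henorm]
  rw [← ofReal_integral_eq_lintegral_ofReal
      ((hcont.integrableOn_Icc (a := 0) (b := 2 * Real.pi)).mono_set Set.Ioc_subset_Icc_self)
      (ae_of_all _ fun θ => by positivity),
    ← ENNReal.ofReal_inv_of_pos hpi, ← ENNReal.ofReal_mul (by positivity),
    ← intervalIntegral.integral_of_le hpi.le]
  exact ENNReal.ofReal_le_ofReal (rpow_norm_le_circleAverage hφ hα)

/-- Multiplication by a unimodular number preserves Lebesgue measure on `ℂⁿ`. -/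
lemma measurePreserving_smul_of_norm_eq_one {n : ℕ} {c : ℂ} (hc : ‖c‖ = 1) :
    MeasurePreserving (fun z : Fin n → ℂ => c • z) := by
  have h1 : MeasurePreserving (fun z : ℂ => c * z) := 
    (rotation ⟨c, mem_sphere_zero_iff_norm.2 hc⟩).measurePreserving
  exact volume_preserving_pi fun _ : Fin n => h1

lemma norm_circleMap_zero_one (θ : ℝ) : ‖circleMap 0 1 θ‖ = 1 := by simp

/-- Sub-mean value property over balls. -/
lemma mul_volume_ball_le_setLIntegral {n : ℕ} {F : (Fin n → ℂ) → ℝ≥0∞} (hF : Measurable F)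
    {w : Fin n → ℂ} {r : ℝ}
    (h : ∀ v ∈ Metric.ball (0 : Fin n → ℂ) r, F w ≤ (ENNReal.ofReal (2 * Real.pi))⁻¹ *
      ∫⁻ θ in Set.Ioc 0 (2 * Real.pi), F (w + circleMap 0 1 θ • v)) :
    F w * volume (Metric.ball (0 : Fin n → ℂ) r) ≤ ∫⁻ z in Metric.ball w r, F z := by
  have hpi : ENNReal.ofReal (2 * Real.pi) ≠ 0 := by simp [Real.pi_pos]
  have hjoint : Measurable fun p : (Fin n → ℂ) × ℝ => F (w + circleMap 0 1 p.2 • p.1) := by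
    refine hF.comp (Continuous.measurable ?_)
    have := continuous_circleMap 0 1
    fun_prop
  -- Rotations preserve the ball and its measure, so averaging over `θ` does not change the
  -- integral.
  have hrot : ∀ θ : ℝ, ∫⁻ v in Metric.ball (0 : Fin n → ℂ) r, F (w + circleMap 0 1 θ • v)
      = ∫⁻ z in Metric.ball w r, F z := by
    intro θ
    have hpre : (fun v : Fin n → ℂ => circleMap 0 1 θ • v) ⁻¹' Metric.ball 0 r
        = Metric.ball 0 r := by
      ext v; simp [norm_smul]
    have htr : (fun v : Fin n → ℂ => w + v) ⁻¹' Metric.ball w r = Metric.ball 0 r := by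
      ext v; simp
    have h1 := (measurePreserving_smul_of_norm_eq_one (n := n)
      (norm_circleMap_zero_one θ)).setLIntegral_comp_preimage (s := Metric.ball 0 r)
      measurableSet_ball (f := fun v => F (w + v)) (hF.comp (measurable_const_add w))
    have h2 := (measurePreserving_add_left volume w).setLIntegral_comp_preimage
      (s := Metric.ball w r) measurableSet_ball hF
    rw [hpre] at h1
    rw [htr] at h2
    rw [h1, h2]
  calc F w * volume (Metric.ball (0 : Fin n → ℂ) r)
      = ∫⁻ _ in Metric.ball (0 : Fin n → ℂ) r, F w := (setLIntegral_const _ _).symm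
    _ ≤ ∫⁻ v in Metric.ball (0 : Fin n → ℂ) r, (ENNReal.ofReal (2 * Real.pi))⁻¹ *
          ∫⁻ θ in Set.Ioc 0 (2 * Real.pi), F (w + circleMap 0 1 θ • v) :=
        setLIntegral_mono' measurableSet_ball h
    _ = (ENNReal.ofReal (2 * Real.pi))⁻¹ * ∫⁻ θ in Set.Ioc 0 (2 * Real.pi),
          ∫⁻ v in Metric.ball (0 : Fin n → ℂ) r, F (w + circleMap 0 1 θ • v) := by
        rw [lintegral_const_mul _ hjoint.lintegral_prod_right',
          lintegral_lintegral_swap hjoint.aemeasurable]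
    _ = ∫⁻ z in Metric.ball w r, F z := by
        simp only [hrot, lintegral_const, Measure.restrict_apply_univ, Real.volume_Ioc, sub_zero]
        rw [mul_comm, mul_assoc, ENNReal.mul_inv_cancel hpi ENNReal.ofReal_ne_top, mul_one]

lemma measurable_indicator_of_continuousOn {X : Type*} [TopologicalSpace X] [MeasurableSpace X]
    [BorelSpace X] {f : X → ℂ} {s : Set X} (hs : MeasurableSet s) (hf : ContinuousOn f s) :
    Measurable (s.indicator f) := by
  classical
  rw [← Set.piecewise_eq_indicator]
  exact hf.measurable_piecewise continuousOn_const hs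

/-- Sub-mean value property of `|f|^α` over balls, for `f` holomorphic. -/
lemma enorm_rpow_mul_volume_ball_le {n : ℕ} {f : (Fin n → ℂ) → ℂ} {w : Fin n → ℂ} {r : ℝ}
    (hf : DifferentiableOn ℂ f (Metric.ball w r)) {α : ℝ} (hα : 0 < α) (hr : 0 < r) :
    ‖f w‖ₑ ^ α * volume (Metric.ball (0 : Fin n → ℂ) r)
      ≤ ∫⁻ z in Metric.ball w r, ‖f z‖ₑ ^ α := by
  set F : (Fin n → ℂ) → ℝ≥0∞ := (Metric.ball w r).indicator fun z => ‖f z‖ₑ ^ α with hFdef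
  have hF : Measurable F := by
    have h1 := (measurable_indicator_of_continuousOn measurableSet_ball
      hf.continuousOn).enorm.pow_const α
    convert h1 using 1
    ext z
    by_cases hz : z ∈ Metric.ball w r <;> simp [hFdef, hz, hα]
  have h := mul_volume_ball_le_setLIntegral hF (w := w) (r := r) fun v hv => by
    have hmem : ∀ t ∈ Metric.closedBall (0 : ℂ) 1, w + t • v ∈ Metric.ball w r := by
      intro t ht
      rw [mem_closedBall_zero_iff] at ht
      rw [mem_ball_zero_iff] at hv
      simp only [Metric.mem_ball, dist_self_add_left, norm_smul]
      exact (mul_le_of_le_one_left (norm_nonneg v) ht).trans_lt hv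
    have han : AnalyticOnNhd ℂ (fun t : ℂ => f (w + t • v)) (Metric.closedBall 0 1) := by
      intro t ht
      refine DifferentiableOn.analyticAt (s := (fun t : ℂ => w + t • v) ⁻¹' Metric.ball w r)
        (hf.comp (by fun_prop) fun t ht => ht)
        ((Metric.isOpen_ball.preimage (by fun_prop)).mem_nhds (hmem t ht))
    have := enorm_rpow_le_lintegral_circleMap han hα
    rw [zero_smul, add_zero] at this
    have hw : F w = ‖f w‖ₑ ^ α := Set.indicator_of_mem (Metric.mem_ball_self hr) _
    rw [hw]
    refine this.trans_eq ?_
    congr 1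
    refine lintegral_congr fun θ => ?_
    rw [hFdef, Set.indicator_of_mem (hmem _ (by simp))]
  rwa [hFdef, Set.indicator_of_mem (Metric.mem_ball_self hr),
    setLIntegral_indicator measurableSet_ball, Set.inter_self] at h

/-- **Hartogs' lemma** for the functions `|f_d|^{1/d}`. -/
lemma exists_forall_enorm_le_pow_of_limsup_le {n : ℕ} {f : ℕ → (Fin n → ℂ) → ℂ}
    (hf : ∀ d, Differentiable ℂ (f d)) {z₀ : Fin n → ℂ} {r : ℝ} (hr : 0 < r) {q : ℝ≥0∞}
    (hq : q < 1)
    (hlim : ∀ z ∈ Metric.ball z₀ r, limsup (fun d : ℕ => ‖f d z‖ₑ ^ (1 / (d : ℝ))) atTop ≤ q)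
    {M : ℝ≥0} (hM : ∀ d, ∀ z ∈ Metric.ball z₀ r, ‖f d z‖ₑ ^ (1 / (d : ℝ)) ≤ M) :
    ∃ ρ > 0, ∃ q' : ℝ≥0, q' < 1 ∧ ∀ᶠ d in atTop, ∀ w ∈ Metric.ball z₀ ρ, ‖f d w‖ₑ ≤ q' ^ d := by
  obtain ⟨q', hqq', hq'⟩ := ENNReal.lt_iff_exists_nnreal_btwn.1 hq
  set m := Module.finrank ℝ (Fin n → ℂ)
  -- Balls of radii `r` and `s = r / (1 + δ)` have volume ratio `(1 + δ) ^ m`; with `δ` small this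
  -- loss fits between `q` and `q'`.
  have hδ : ∀ᶠ δ : ℝ in 𝓝[>] 0, ENNReal.ofReal ((1 + δ) ^ m) * q < q' := by
    have : Tendsto (fun δ : ℝ => ENNReal.ofReal ((1 + δ) ^ m) * q) (𝓝 0)
        (𝓝 (ENNReal.ofReal ((1 + 0) ^ m) * q)) := by
      refine ENNReal.Tendsto.mul_const (ENNReal.tendsto_ofReal (Continuous.tendsto (by fun_prop) 0))
        (Or.inr hq.ne_top)
    simp only [add_zero, one_pow, ENNReal.ofReal_one, one_mul] at this
    exact (this.mono_left nhdsWithin_le_nhds).eventually_lt_const hqq'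
  obtain ⟨δ, hδq, hδ0⟩ := (hδ.and self_mem_nhdsWithin).exists
  replace hδ0 : 0 < δ := hδ0
  set s := r / (1 + δ) with hs
  have hs0 : 0 < s := by positivity
  have hrs : r = (1 + δ) * s := by rw [hs]; field_simp
  have hvol : volume (Metric.ball z₀ r) = ENNReal.ofReal ((1 + δ) ^ m) *
      volume (Metric.ball (0 : Fin n → ℂ) s) := by
    rw [hrs, Measure.addHaar_ball_mul_of_pos volume z₀ (by positivity) s]
  have hv0 : volume (Metric.ball (0 : Fin n → ℂ) s) ≠ 0 := (Metric.measure_ball_pos _ _ hs0).ne'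
  have hvt : volume (Metric.ball (0 : Fin n → ℂ) s) ≠ ∞ := measure_ball_lt_top.ne
  -- Reverse Fatou, with the constant `M` as dominating function.
  have hlt : limsup (fun d : ℕ => ∫⁻ z in Metric.ball z₀ r, ‖f d z‖ₑ ^ (1 / (d : ℝ))) atTop
      < q' * volume (Metric.ball (0 : Fin n → ℂ) s) := by
    calc _ ≤ ∫⁻ z in Metric.ball z₀ r, limsup (fun d : ℕ => ‖f d z‖ₑ ^ (1 / (d : ℝ))) atTop := by
          refine limsup_lintegral_le (fun _ => (M : ℝ≥0∞))
            (fun d => ((hf d).continuous.measurable.enorm).pow_const _) (fun d => ?_) ?_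
          · exact (ae_restrict_iff' measurableSet_ball).2 (ae_of_all _ fun z hz => hM d z hz)
          · rw [setLIntegral_const]
            exact ENNReal.mul_ne_top ENNReal.coe_ne_top measure_ball_lt_top.ne
      _ ≤ ∫⁻ _ in Metric.ball z₀ r, q := setLIntegral_mono' measurableSet_ball hlim
      _ = (ENNReal.ofReal ((1 + δ) ^ m) * q) * volume (Metric.ball (0 : Fin n → ℂ) s) := by
          rw [setLIntegral_const, hvol]; ring
      _ < _ := (ENNReal.mul_lt_mul_iff_left hv0 hvt).2 hδq
  refine ⟨r - s, ?_, q', by exact_mod_cast hq', ?_⟩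
  · rw [hrs]; nlinarith
  filter_upwards [eventually_lt_of_limsup_lt hlt, eventually_gt_atTop 0] with d hd hd0 w hw
  have hsub : Metric.ball w s ⊆ Metric.ball z₀ r :=
    Metric.ball_subset_ball' (by rw [Metric.mem_ball] at hw; linarith)
  have hd' : (0 : ℝ) < 1 / d := by positivity
  have h1 := (enorm_rpow_mul_volume_ball_le (w := w) ((hf d).differentiableOn) hd' hs0).trans
    (lintegral_mono_set hsub)
  have h2 := (ENNReal.mul_lt_mul_iff_left hv0 hvt).1 (h1.trans_lt hd)
  rw [one_div, ENNReal.rpow_inv_lt_iff (by positivity), ENNReal.rpow_natCast] at h2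
  exact h2.le

/-- Root test: geometric domination on a ball gives uniform convergence of the series. -/
lemma tendstoUniformlyOn_sum_of_enorm_le_pow {X : Type*} {f : ℕ → X → ℂ} {s : Set X} {q : ℝ≥0}
    (hq : q < 1) (h : ∀ᶠ d in atTop, ∀ w ∈ s, ‖f d w‖ₑ ≤ q ^ d) :
    TendstoUniformlyOn (fun (N : ℕ) z => ∑ d ∈ Finset.range N, f d z) (fun z => ∑' d, f d z)
      atTop s := by
  refine tendstoUniformlyOn_tsum_nat_eventually (u := fun d => (q : ℝ) ^ d)
    (summable_geometric_of_lt_one q.2 (by exact_mod_cast hq)) ?_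
  filter_upwards [h] with d hd w hw
  have := hd w hw
  rw [← ofReal_norm, ← ENNReal.coe_pow, ← ENNReal.ofReal_coe_nnreal,
    ENNReal.ofReal_le_ofReal_iff NNReal.zero_le_coe] at this
  simpa using this

/-! ### Series of homogeneous polynomials. -/

lemma MvPolynomial.IsHomogeneous.eval_smul {n d : ℕ} {P : MvPolynomial (Fin n) ℂ}
    (hP : P.IsHomogeneous d) (c : ℂ) (z : Fin n → ℂ) :
    MvPolynomial.eval (c • z) P = c ^ d * MvPolynomial.eval z P := by
  rw [MvPolynomial.eval_eq', MvPolynomial.eval_eq', Finset.mul_sum]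
  refine Finset.sum_congr rfl fun m hm => ?_
  have hdeg : ∑ i, m i = d := by
    have := hP (MvPolynomial.mem_support_iff.1 hm)
    rwa [show (1 : Fin n → ℕ) = fun _ => 1 from rfl, ← Finsupp.degree_eq_weight_one, Finsupp.degree_eq_sum] at this
  simp only [Pi.smul_apply, smul_eq_mul, mul_pow, Finset.prod_mul_distrib]
  rw [Finset.prod_pow_eq_pow_sum, hdeg]
  ring

lemma MvPolynomial.differentiable_eval {n : ℕ} (P : MvPolynomial (Fin n) ℂ) :
    Differentiable ℂ fun z => MvPolynomial.eval z P := by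
  induction P using MvPolynomial.induction_on with
  | C a => simp
  | add p q hp hq => simpa [Pi.add_def] using hp.add hq
  | mul_X p i hp =>
    simp only [map_mul, MvPolynomial.eval_X]
    exact hp.mul (differentiable_apply i)

/-- A series of homogeneous polynomials that is locally bounded near `0` converges locally
uniformly near the points in whose neighbourhood the radius function is bounded by some `q < 1`. -/
lemma tendstoLocallyUniformlyOn_sum_eval {n : ℕ} {P : ℕ → MvPolynomial (Fin n) ℂ}
    (hP : ∀ d, (P d).IsHomogeneous d) {C r : ℝ} (hr : 0 < r)
    (hC : ∀ d, ∀ z ∈ Metric.ball (0 : Fin n → ℂ) r, ‖MvPolynomial.eval z (P d)‖ ≤ C)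
    {U : Set (Fin n → ℂ)}
    (hU : ∀ z ∈ U, ∃ q < (1 : ℝ≥0∞), ∀ᶠ w in 𝓝 z, expansionRadiusFn P w ≤ q) :
    TendstoLocallyUniformlyOn
      (fun (N : ℕ) (z : Fin n → ℂ) => ∑ d ∈ Finset.range N, MvPolynomial.eval z (P d))
      (fun z => ∑' d, MvPolynomial.eval z (P d)) atTop U := by
  refine tendstoLocallyUniformlyOn_of_forall_exists_nhds fun z₀ hz₀ => ?_
  obtain ⟨q, hq, hev⟩ := hU z₀ hz₀
  obtain ⟨ρ, hρ, hball⟩ := Metric.eventually_nhds_iff_ball.1 hev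
  set K : ℝ≥0 := max C.toNNReal 1
  -- Dividing by `c` moves the ball around `z₀` into the ball where `C` bounds every term;
  -- homogeneity then gives `|P_d| ≤ (c * K) ^ d` for `d > 0`, the uniform bound that Hartogs' lemma
  -- needs.
  set c : ℝ≥0 := max ((‖z₀‖ + ρ) / r).toNNReal 1
  have hc0 : 0 < (c : ℝ) := lt_of_lt_of_le one_pos (by exact_mod_cast le_max_right _ _)
  have hM : ∀ d, ∀ z ∈ Metric.ball z₀ ρ,
      ‖MvPolynomial.eval z (P d)‖ₑ ^ (1 / (d : ℝ)) ≤ ((c * K : ℝ≥0) : ℝ≥0∞) := by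
    intro d z hz
    rcases Nat.eq_zero_or_pos d with rfl | hd
    · simp only [CharP.cast_eq_zero, div_zero, ENNReal.rpow_zero]
      exact_mod_cast one_le_mul (le_max_right _ _) (le_max_right _ _)
    have hz' : ((c : ℂ)⁻¹) • z ∈ Metric.ball (0 : Fin n → ℂ) r := by
      rw [mem_ball_zero_iff, norm_smul, norm_inv, Complex.norm_of_nonneg (NNReal.coe_nonneg c),
        inv_mul_lt_iff₀ hc0]
      have h1 : ‖z‖ < ‖z₀‖ + ρ := by
        rw [Metric.mem_ball, dist_eq_norm] at hz
        have := norm_le_norm_add_norm_sub' z z₀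
        linarith
      have h2 : (‖z₀‖ + ρ) / r ≤ c := (Real.le_coe_toNNReal _).trans
        (by exact_mod_cast le_max_left _ _)
      rw [div_le_iff₀ hr] at h2
      linarith
    have h1 : MvPolynomial.eval z (P d)
        = (c : ℂ) ^ d * MvPolynomial.eval (((c : ℂ)⁻¹) • z) (P d) := by
      rw [← (hP d).eval_smul, smul_inv_smul₀]
      exact_mod_cast hc0.ne'
    have h2 : ‖MvPolynomial.eval z (P d)‖₊ ≤ (c * K) ^ d := by
      rw [h1, nnnorm_mul, nnnorm_pow, mul_pow]
      have h3 : ‖(c : ℂ)‖₊ = c := by ext; simp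
      rw [h3]
      gcongr
      refine le_trans ?_ (le_self_pow₀ (le_max_right _ _) hd.ne')
      refine le_trans ?_ (le_max_left _ _)
      exact NNReal.le_toNNReal_of_coe_le (hC d _ hz')
    rw [one_div, ENNReal.rpow_inv_le_iff (by positivity), ENNReal.rpow_natCast]
    exact_mod_cast h2
  obtain ⟨σ, hσ, q', hq', h⟩ := exists_forall_enorm_le_pow_of_limsup_le
    (fun d => (P d).differentiable_eval) hρ hq hball hM
  exact ⟨Metric.ball z₀ σ, mem_nhdsWithin_of_mem_nhds (Metric.ball_mem_nhds _ hσ),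
    tendstoUniformlyOn_sum_of_enorm_le_pow hq' h⟩

/-! ### Elementary geometry of balanced domains. -/

section BalancedDomain

variable {n : ℕ} {h : (Fin n → ℂ) → ℝ≥0}

lemma IsBalancedGauge.isOpen_balancedDomain (hh : IsBalancedGauge h) :
    IsOpen (balancedDomain h) :=
  hh.upperSemicontinuous.isOpen_preimage 1

lemma IsBalancedGauge.apply_zero (hh : IsBalancedGauge h) : h 0 = 0 := by
  simpa using hh.homogeneous 0 0

lemma IsBalancedGauge.zero_mem_balancedDomain (hh : IsBalancedGauge h) :
    (0 : Fin n → ℂ) ∈ balancedDomain h := by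
  simp [balancedDomain, hh.apply_zero]

lemma IsBalancedGauge.smul_mem_balancedDomain (hh : IsBalancedGauge h) {c : ℂ} (hc : ‖c‖ ≤ 1)
    {z : Fin n → ℂ} (hz : z ∈ balancedDomain h) : c • z ∈ balancedDomain h := by
  simp only [balancedDomain, Set.mem_ofPred_eq, hh.homogeneous] at hz ⊢
  exact (mul_le_of_le_one_left' (by exact_mod_cast hc)).trans_lt hz

lemma IsBalancedGauge.preimage_smul_balancedDomain (hh : IsBalancedGauge h) {c : ℂ}
    (hc : ‖c‖ = 1) : (fun z => c • z) ⁻¹' balancedDomain h = balancedDomain h := by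
  ext z
  have : ‖c‖₊ = 1 := by ext; simpa using hc
  simp [balancedDomain, hh.homogeneous, this]

/-- A set that is stable under multiplication by `t ∈ [0, 1]` is connected. -/
lemma isConnected_of_forall_smul_mem {U : Set (Fin n → ℂ)} (h0 : (0 : Fin n → ℂ) ∈ U)
    (hU : ∀ z ∈ U, ∀ t : ℝ, 0 ≤ t → t ≤ 1 → (t : ℂ) • z ∈ U) : IsConnected U := by
  have hs : StarConvex ℝ (0 : Fin n → ℂ) U := by
    rw [starConvex_zero_iff]
    intro z hz t ht ht1
    have := hU z hz t ht ht1
    rwa [Complex.coe_smul] at this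
  exact (hs.isPathConnected h0).isConnected

lemma IsBalancedGauge.isComplexDomain_balancedDomain (hh : IsBalancedGauge h) :
    IsComplexDomain (balancedDomain h) := by
  refine ⟨hh.isOpen_balancedDomain, isConnected_of_forall_smul_mem hh.zero_mem_balancedDomain ?_⟩
  intro z hz t ht ht1
  exact hh.smul_mem_balancedDomain (by rwa [Complex.norm_of_nonneg ht]) hz

end BalancedDomain

/-! ### The Bergman space: bounded point evaluations and completeness. -/

section BergmanSpace

variable {n : ℕ} {D : Set (Fin n → ℂ)}

lemma eLpNorm_two_sq {X : Type*} [MeasurableSpace X] (μ : Measure X) (f : X → ℂ) :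
    eLpNorm f 2 μ ^ 2 = ∫⁻ x, ‖f x‖ₑ ^ 2 ∂μ := by
  have := eLpNorm_nnreal_pow_eq_lintegral (f := f) (μ := μ) (p := 2) two_ne_zero
  simpa using this

lemma enorm_sq_mul_volume_ball_le {f : (Fin n → ℂ) → ℂ} (hf : DifferentiableOn ℂ f D)
    {w : Fin n → ℂ} {r : ℝ} (hr : 0 < r) (hw : Metric.ball w r ⊆ D) :
    ‖f w‖ₑ ^ 2 * volume (Metric.ball (0 : Fin n → ℂ) r)
      ≤ eLpNorm f 2 (volume.restrict D) ^ 2 := by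
  have := (enorm_rpow_mul_volume_ball_le (hf.mono hw) two_pos hr).trans (lintegral_mono_set hw)
  rw [eLpNorm_two_sq]
  simpa using this

/-- The holomorphic representative of an element of the Bergman space. -/
noncomputable def bergmanRep (F : bergmanSpace D) : (Fin n → ℂ) → ℂ := F.2.choose

lemma bergmanRep_mem (F : bergmanSpace D) : bergmanRep F ∈ L2Hol D := F.2.choose_spec.1

lemma coeFn_ae_eq_bergmanRep (F : bergmanSpace D) :
    (F : Lp ℂ 2 (volume.restrict D)) =ᵐ[volume.restrict D] bergmanRep F := F.2.choose_spec.2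

/-- Continuous functions that agree almost everywhere on an open set agree on it. Hence the
representative, although obtained by choice, is determined on `D` and depends linearly on `F` there.
-/
lemma bergmanRep_eqOn (hD : IsOpen D) {F : bergmanSpace D} {f : (Fin n → ℂ) → ℂ}
    (hf : DifferentiableOn ℂ f D)
    (hF : (F : Lp ℂ 2 (volume.restrict D)) =ᵐ[volume.restrict D] f) :
    Set.EqOn (bergmanRep F) f D :=
  Measure.eqOn_open_of_ae_eq ((coeFn_ae_eq_bergmanRep F).symm.trans hF) hD
    (bergmanRep_mem F).1.continuousOn hf.continuousOn

lemma bergmanRep_add (hD : IsOpen D) (F G : bergmanSpace D) {z : Fin n → ℂ} (hz : z ∈ D) :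
    bergmanRep (F + G) z = bergmanRep F z + bergmanRep G z :=
  bergmanRep_eqOn hD ((bergmanRep_mem F).1.add (bergmanRep_mem G).1)
    ((Lp.coeFn_add _ _).trans ((coeFn_ae_eq_bergmanRep F).add (coeFn_ae_eq_bergmanRep G))) hz

lemma bergmanRep_smul (hD : IsOpen D) (c : ℂ) (F : bergmanSpace D) {z : Fin n → ℂ} (hz : z ∈ D) :
    bergmanRep (c • F) z = c * bergmanRep F z :=
  bergmanRep_eqOn hD ((bergmanRep_mem F).1.const_smul c)
    ((Lp.coeFn_smul _ _).trans ((coeFn_ae_eq_bergmanRep F).const_smul c)) hz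

/-- The element of the Bergman space defined by a square integrable holomorphic function. -/
noncomputable def bergmanMk (f : (Fin n → ℂ) → ℂ) (hf : f ∈ L2Hol D) : bergmanSpace D :=
  ⟨hf.2.toLp f, f, hf, hf.2.coeFn_toLp⟩

lemma bergmanRep_mk (hD : IsOpen D) {f : (Fin n → ℂ) → ℂ} (hf : f ∈ L2Hol D) :
    Set.EqOn (bergmanRep (bergmanMk f hf)) f D :=
  bergmanRep_eqOn hD hf.1 hf.2.coeFn_toLp

lemma enorm_bergmanSpace (F : bergmanSpace D) :
    ‖F‖ₑ = eLpNorm (bergmanRep F) 2 (volume.restrict D) := by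
  rw [← eLpNorm_congr_ae (coeFn_ae_eq_bergmanRep F), ← Lp.enorm_def]
  rfl

/-- Point evaluations on the Bergman space are bounded, uniformly away from the boundary. -/
lemma exists_norm_bergmanRep_le (D : Set (Fin n → ℂ)) {r : ℝ} (hr : 0 < r) :
    ∃ C : ℝ, 0 ≤ C ∧ ∀ w, Metric.ball w r ⊆ D → ∀ F : bergmanSpace D,
      ‖bergmanRep F w‖ ≤ C * ‖F‖ := by
  set V := (volume (Metric.ball (0 : Fin n → ℂ) r)).toReal
  have hV : 0 < V := ENNReal.toReal_pos (Metric.measure_ball_pos _ _ hr).ne' measure_ball_lt_top.ne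
  refine ⟨(Real.sqrt V)⁻¹, by positivity, fun w hw F => ?_⟩
  have h1 := enorm_sq_mul_volume_ball_le (bergmanRep_mem F).1 hr hw
  rw [← enorm_bergmanSpace] at h1
  have h2 := ENNReal.toReal_mono (by simp) h1
  rw [ENNReal.toReal_mul, ENNReal.toReal_pow, ENNReal.toReal_pow, toReal_enorm, toReal_enorm] at h2
  rw [← div_eq_inv_mul, le_div_iff₀ (by positivity)]
  refine abs_le_of_sq_le_sq' ?_ (norm_nonneg _) |>.2
  rw [mul_pow, Real.sq_sqrt hV.le]
  exact h2

/-- Point evaluation on the Bergman space. -/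
noncomputable def bergmanEval (hD : IsOpen D) {z : Fin n → ℂ} (hz : z ∈ D) :
    bergmanSpace D →L[ℂ] ℂ :=
  LinearMap.mkContinuousOfExistsBound
    { toFun := fun F => bergmanRep F z
      map_add' := fun F G => bergmanRep_add hD F G hz
      map_smul' := fun c F => bergmanRep_smul hD c F hz } <| by
    obtain ⟨r, hr, hrD⟩ := Metric.isOpen_iff.1 hD z hz
    obtain ⟨C, -, hC⟩ := exists_norm_bergmanRep_le D hr
    exact ⟨C, hC z hrD⟩

@[simp] lemma bergmanEval_apply (hD : IsOpen D) {z : Fin n → ℂ} (hz : z ∈ D)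
    (F : bergmanSpace D) : bergmanEval hD hz F = bergmanRep F z := rfl

/-- The Bergman space is closed in `L²`. -/
lemma isClosed_bergmanSpace (hD : IsOpen D) :
    IsClosed (bergmanSpace D : Set (Lp ℂ 2 ((volume : Measure (Fin n → ℂ)).restrict D))) := by
  refine isSeqClosed_iff_isClosed.1 fun u F hu hF => ?_
  set G : ℕ → bergmanSpace D := fun k => ⟨u k, hu k⟩
  have hGc : CauchySeq G := by
    have := hF.cauchySeq
    rw [Metric.cauchySeq_iff] at this ⊢
    exact this
  have hlim : ∀ z ∈ D, ∃ L, Tendsto (fun k => bergmanRep (G k) z) atTop (𝓝 L) := fun z hz =>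
    cauchySeq_tendsto_of_complete
      ((bergmanEval hD hz).uniformContinuous.comp_cauchySeq hGc)
  choose! f hf using hlim
  have hloc : TendstoLocallyUniformlyOn (fun k => bergmanRep (G k)) f atTop D := by
    refine tendstoLocallyUniformlyOn_of_forall_exists_nhds fun z hz => ?_
    obtain ⟨r, hr, hrD⟩ := Metric.isOpen_iff.1 hD z hz
    obtain ⟨C, hC0, hC⟩ := exists_norm_bergmanRep_le D (half_pos hr)
    have hsub : ∀ y ∈ Metric.ball z (r / 2), Metric.ball y (r / 2) ⊆ D := fun y hy =>
      (Metric.ball_subset_ball' (by rw [Metric.mem_ball] at hy; linarith)).trans hrD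
    have hmem : ∀ y ∈ Metric.ball z (r / 2), y ∈ D := fun y hy =>
      hsub y hy (Metric.mem_ball_self (half_pos hr))
    refine ⟨Metric.ball z (r / 2), mem_nhdsWithin_of_mem_nhds (Metric.ball_mem_nhds z (half_pos hr)),
      UniformCauchySeqOn.tendstoUniformlyOn_of_tendsto ?_ fun y hy => hf y (hmem y hy)⟩
    rw [Metric.uniformCauchySeqOn_iff]
    rw [Metric.cauchySeq_iff] at hGc
    intro ε hε
    obtain ⟨N, hN⟩ := hGc (ε / (C + 1)) (by positivity)
    refine ⟨N, fun m hm k hk y hy => ?_⟩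
    have h1 := hN m hm k hk
    have h2 : bergmanRep (G m) y - bergmanRep (G k) y = bergmanRep (G m - G k) y :=
      (map_sub (bergmanEval hD (hmem y hy)) (G m) (G k)).symm
    rw [dist_eq_norm] at h1 ⊢
    rw [h2]
    calc _ ≤ C * ‖G m - G k‖ := hC y (hsub y hy) _
      _ ≤ (C + 1) * ‖G m - G k‖ := by gcongr; linarith
      _ < (C + 1) * (ε / (C + 1)) := by gcongr
      _ = ε := by field_simp
  have hfd : DifferentiableOn ℂ f D :=
    differentiableOn_of_tendstoLocallyUniformlyOn hD (fun k => (bergmanRep_mem (G k)).1) hloc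
  -- An almost everywhere convergent subsequence identifies the `L²` limit with the locally uniform
  -- limit `f`.
  obtain ⟨ns, hns, hae⟩ := (tendstoInMeasure_of_tendsto_Lp hF).exists_seq_tendsto_ae
  have hall : ∀ᵐ z ∂(volume.restrict D), ∀ k, (u k) z = bergmanRep (G k) z :=
    ae_all_iff.2 fun k => coeFn_ae_eq_bergmanRep (G k)
  have hFf : F =ᵐ[volume.restrict D] f := by
    filter_upwards [hae, hall, ae_restrict_mem hD.measurableSet] with z h1 h2 hz
    have h3 := (hf z hz).comp hns.tendsto_atTop
    simp only [h2] at h1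
    exact tendsto_nhds_unique h1 h3
  exact ⟨f, ⟨hfd, (memLp_congr_ae hFf).1 (Lp.memLp F)⟩, hFf⟩

lemma completeSpace_bergmanSpace (hD : IsOpen D) : CompleteSpace (bergmanSpace D) :=
  (isClosed_bergmanSpace hD).completeSpace_coe

end BergmanSpace

/-! ### Taylor coefficients as circle averages. -/

/-- The uniform probability measure on the parameter interval of the unit circle. -/
noncomputable def circleParamMeasure : Measure ℝ :=
  (ENNReal.ofReal (2 * Real.pi))⁻¹ • volume.restrict (Set.Ioc 0 (2 * Real.pi))

instance isProbabilityMeasure_circleParamMeasure : IsProbabilityMeasure circleParamMeasure := by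
  constructor
  have hpi : ENNReal.ofReal (2 * Real.pi) ≠ 0 := by simp [Real.pi_pos]
  simp only [circleParamMeasure, Measure.smul_apply, smul_eq_mul, Measure.restrict_apply_univ,
    Real.volume_Ioc, sub_zero]
  exact ENNReal.inv_mul_cancel hpi ENNReal.ofReal_ne_top

lemma circleAverage_eq_integral_circleParamMeasure (φ : ℂ → ℂ) :
    Real.circleAverage φ 0 1 = ∫ θ, φ (circleMap 0 1 θ) ∂circleParamMeasure := by
  rw [circleParamMeasure, integral_smul_measure, Real.circleAverage,
    intervalIntegral.integral_of_le Real.two_pi_pos.le, ENNReal.toReal_inv,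
    ENNReal.toReal_ofReal Real.two_pi_pos.le]

/-- Cauchy's formula for Taylor coefficients as an average over the unit circle. -/
lemma iteratedDeriv_eq_integral_circleParamMeasure {φ : ℂ → ℂ} {S : Set ℂ}
    (hφ : DifferentiableOn ℂ φ S) (hsub : Metric.closedBall 0 1 ⊆ S) (d : ℕ) :
    iteratedDeriv d φ 0 = d.factorial *
      ∫ θ, ((circleMap 0 1 θ) ^ d)⁻¹ * φ (circleMap 0 1 θ) ∂circleParamMeasure := by
  have h1 := DiffContOnCl.circleIntegral_one_div_sub_center_pow_smul one_pos d
    (hφ.diffContOnCl_ball hsub)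
  rw [← circleAverage_eq_integral_circleParamMeasure (fun t => (t ^ d)⁻¹ * φ t),
    Real.circleAverage_eq_circleIntegral one_ne_zero]
  have h2 : (∮ z in C(0, 1), (z - 0)⁻¹ • ((z ^ d)⁻¹ * φ z))
      = ∮ z in C(0, 1), (1 / (z - 0) ^ (d + 1)) • φ z := by
    congr 1
    ext z
    simp only [sub_zero, smul_eq_mul, one_div, pow_succ, mul_inv]
    ring
  rw [h2, h1]
  have h3 : (d.factorial : ℂ) ≠ 0 := by exact_mod_cast d.factorial_ne_zero
  have h4 : (2 * Real.pi * Complex.I : ℂ) ≠ 0 := Complex.two_pi_I_ne_zero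
  simp only [smul_eq_mul]
  field_simp

/-! ### Homogeneous parts of the Bergman space. -/

section HomogeneousPart

variable {n : ℕ} {D : Set (Fin n → ℂ)}

noncomputable instance innerBergmanSpace : Inner ℂ (bergmanSpace D) :=
  InnerProductSpace.toInner

lemma inner_bergmanSpace (F G : bergmanSpace D) :
    inner ℂ F G = ∫ z in D, starRingEnd ℂ (bergmanRep F z) * bergmanRep G z := by
  rw [Submodule.coe_inner, L2.inner_def]
  refine integral_congr_ae ?_
  filter_upwards [coeFn_ae_eq_bergmanRep F, coeFn_ae_eq_bergmanRep G] with z h1 h2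
  rw [h1, h2, RCLike.inner_apply, mul_comm]

/-- Square integrable homogeneous polynomials of degree `d`. -/
def sqIntegrablePolynomials (D : Set (Fin n → ℂ)) (d : ℕ) :
    Submodule ℂ (MvPolynomial (Fin n) ℂ) where
  carrier := {P | P.IsHomogeneous d ∧
    MemLp (fun z => MvPolynomial.eval z P) 2 (volume.restrict D)}
  zero_mem' := ⟨MvPolynomial.isHomogeneous_zero _ _ _, by simp⟩
  add_mem' := by
    rintro P Q ⟨hP, hP2⟩ ⟨hQ, hQ2⟩
    exact ⟨hP.add hQ, by simpa [Pi.add_def] using hP2.add hQ2⟩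
  smul_mem' := by
    rintro c P ⟨hP, hP2⟩
    refine ⟨(MvPolynomial.homogeneousSubmodule (Fin n) ℂ d).smul_mem c hP, ?_⟩
    simpa [MvPolynomial.smul_eval, Pi.smul_def] using hP2.const_smul c

instance finiteDimensional_sqIntegrablePolynomials (d : ℕ) :
    FiniteDimensional ℂ (sqIntegrablePolynomials D d) := by
  have : FiniteDimensional ℂ (MvPolynomial.homogeneousSubmodule (Fin n) ℂ d) :=
    Module.Finite.iff_fg.2 (MvPolynomial.homogeneousSubmodule_fg _ _ d)
  exact Submodule.finiteDimensional_of_le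
    (show sqIntegrablePolynomials D d ≤ MvPolynomial.homogeneousSubmodule (Fin n) ℂ d from
      fun P hP => hP.1)

lemma eval_mem_L2Hol {d : ℕ} {P : MvPolynomial (Fin n) ℂ} (hP : P ∈ sqIntegrablePolynomials D d) :
    (fun z => MvPolynomial.eval z P) ∈ L2Hol D :=
  ⟨P.differentiable_eval.differentiableOn, hP.2⟩

/-- Square integrable homogeneous polynomials as elements of the Bergman space. -/
noncomputable def polynomialToBergman (D : Set (Fin n → ℂ)) (d : ℕ) :
    sqIntegrablePolynomials D d →ₗ[ℂ] bergmanSpace D where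
  toFun P := bergmanMk _ (eval_mem_L2Hol P.2)
  map_add' P Q := by
    have hP := (eval_mem_L2Hol P.2).2
    have hQ := (eval_mem_L2Hol Q.2).2
    exact Subtype.ext ((MemLp.toLp_congr
      (eval_mem_L2Hol (P + Q).2).2 (hP.add hQ)
      (ae_of_all _ fun z => map_add (MvPolynomial.eval z) P.1 Q.1)).trans (MemLp.toLp_add hP hQ))
  map_smul' c P := by
    have hP := (eval_mem_L2Hol P.2).2
    exact Subtype.ext ((MemLp.toLp_congr
      (eval_mem_L2Hol (c • P).2).2 (hP.const_smul c)
      (ae_of_all _ fun z => MvPolynomial.smul_eval z P.1 c)).trans (MemLp.toLp_const_smul c hP))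

/-- The homogeneous part of degree `d` of the Bergman space. -/
noncomputable def bergmanHomogeneousPart (D : Set (Fin n → ℂ)) (d : ℕ) :
    Submodule ℂ (bergmanSpace D) := LinearMap.range (polynomialToBergman D d)

instance finiteDimensional_bergmanHomogeneousPart (d : ℕ) :
    FiniteDimensional ℂ (bergmanHomogeneousPart D d) := by
  unfold bergmanHomogeneousPart
  infer_instance

lemma exists_eval_eq_of_mem_bergmanHomogeneousPart (hD : IsOpen D) {d : ℕ} {F : bergmanSpace D}
    (hF : F ∈ bergmanHomogeneousPart D d) : ∃ P : MvPolynomial (Fin n) ℂ, P.IsHomogeneous d ∧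
      ∀ z ∈ D, bergmanRep F z = MvPolynomial.eval z P := by
  obtain ⟨P, rfl⟩ := hF
  exact ⟨P, P.2.1, bergmanRep_mk hD (eval_mem_L2Hol P.2)⟩

end HomogeneousPart

/-! ### Rotation invariance and orthogonality of degrees. -/

section Rotation

variable {n : ℕ} {h : (Fin n → ℂ) → ℝ≥0}

lemma IsBalancedGauge.measurePreserving_smul (hh : IsBalancedGauge h) {c : ℂ} (hc : ‖c‖ = 1) :
    MeasurePreserving (fun z : Fin n → ℂ => c • z) (volume.restrict (balancedDomain h))
      (volume.restrict (balancedDomain h)) := by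
  have := (measurePreserving_smul_of_norm_eq_one (n := n) hc).restrict_preimage
    (s := balancedDomain h) hh.isOpen_balancedDomain.measurableSet
  rwa [hh.preimage_smul_balancedDomain hc] at this

lemma IsBalancedGauge.setIntegral_comp_smul (hh : IsBalancedGauge h) {c : ℂ} (hc : ‖c‖ = 1)
    (g : (Fin n → ℂ) → ℂ) :
    ∫ z in balancedDomain h, g (c • z) = ∫ z in balancedDomain h, g z := by
  have hc0 : c ≠ 0 := by rintro rfl; simp at hc
  exact (hh.measurePreserving_smul hc).integral_comp
    (Homeomorph.smulOfNeZero c hc0).measurableEmbedding g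

/-- Homogeneous parts of different degrees are orthogonal. -/
lemma IsBalancedGauge.inner_eq_zero_of_ne (hh : IsBalancedGauge h) {d e : ℕ} (hde : d ≠ e)
    {F G : bergmanSpace (balancedDomain h)}
    (hF : F ∈ bergmanHomogeneousPart (balancedDomain h) d)
    (hG : G ∈ bergmanHomogeneousPart (balancedDomain h) e) : inner ℂ F G = 0 := by
  have hD := hh.isOpen_balancedDomain
  obtain ⟨P, hP, hPF⟩ := exists_eval_eq_of_mem_bergmanHomogeneousPart hD hF
  obtain ⟨Q, hQ, hQG⟩ := exists_eval_eq_of_mem_bergmanHomogeneousPart hD hG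
  have hPQ : inner ℂ F G = ∫ z in balancedDomain h,
      starRingEnd ℂ (MvPolynomial.eval z P) * MvPolynomial.eval z Q := by
    rw [inner_bergmanSpace]
    exact setIntegral_congr_fun hD.measurableSet fun z hz => by simp only [hPF z hz, hQG z hz]
  -- A root of unity of order larger than both `d` and `e` separates the two degrees: invariance
  -- under this one rotation forces `c ^ e = c ^ d` unless the inner product is zero.
  have hroot := Complex.isPrimitiveRoot_exp (d + e + 1) (by omega)
  set c := Complex.exp (2 * Real.pi * Complex.I / (d + e + 1 : ℕ))
  have hc : ‖c‖ = 1 := hroot.norm'_eq_one (by omega)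
  have hcc : starRingEnd ℂ c * c = 1 := by
    rw [← Complex.normSq_eq_conj_mul_self, Complex.normSq_eq_norm_sq, hc]; norm_num
  have hrot := hh.setIntegral_comp_smul hc fun z =>
    starRingEnd ℂ (MvPolynomial.eval z P) * MvPolynomial.eval z Q
  have hmul : ∀ z, starRingEnd ℂ (MvPolynomial.eval (c • z) P) * MvPolynomial.eval (c • z) Q
      = (starRingEnd ℂ c ^ d * c ^ e) *
        (starRingEnd ℂ (MvPolynomial.eval z P) * MvPolynomial.eval z Q) := fun z => by
    rw [hP.eval_smul, hQ.eval_smul, map_mul, map_pow]; ring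
  simp only [hmul] at hrot
  rw [integral_const_mul, ← hPQ] at hrot
  by_contra hne
  have h1 : starRingEnd ℂ c ^ d * c ^ e = 1 := mul_right_cancel₀ hne (by rw [hrot, one_mul])
  have h2 : c ^ e = c ^ d := by
    calc c ^ e = (starRingEnd ℂ c * c) ^ d * c ^ e := by rw [hcc]; ring
      _ = (starRingEnd ℂ c ^ d * c ^ e) * c ^ d := by rw [mul_pow]; ring
      _ = c ^ d := by rw [h1, one_mul]
  exact hde (hroot.pow_inj (by omega) (by omega) h2).symm

end Rotation

/-! ### Homogeneous components span: existence of the basis. -/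

section Density

variable {n : ℕ} {h : (Fin n → ℂ) → ℝ≥0}

/-- A radius strictly above `1` allows both Cauchy's formula on the unit circle and the Taylor
series at `t = 1` on the slice through `z`. The value `2 / (1 + h z)` works also when `h z = 0`. -/
lemma IsBalancedGauge.exists_ball_subset_preimage (hh : IsBalancedGauge h) {z : Fin n → ℂ}
    (hz : z ∈ balancedDomain h) :
    ∃ r : ℝ, 1 < r ∧ Metric.ball (0 : ℂ) r ⊆ (fun t : ℂ => t • z) ⁻¹' balancedDomain h := by
  have hz' : (h z : ℝ) < 1 := by exact_mod_cast hz
  have h0 : (0 : ℝ) ≤ h z := NNReal.coe_nonneg _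
  refine ⟨2 / (1 + h z), by rw [lt_div_iff₀ (by positivity)]; linarith, fun t ht => ?_⟩
  rw [mem_ball_zero_iff, lt_div_iff₀ (by positivity)] at ht
  simp only [Set.mem_preimage, balancedDomain, Set.mem_ofPred_eq, hh.homogeneous]
  have : ‖t‖ * h z < 1 := by nlinarith [norm_nonneg t]
  exact_mod_cast this

lemma differentiableOn_comp_smul_balancedDomain {f : (Fin n → ℂ) → ℂ}
    (hf : DifferentiableOn ℂ f (balancedDomain h)) (z : Fin n → ℂ) :
    DifferentiableOn ℂ (fun t : ℂ => f (t • z)) ((fun t : ℂ => t • z) ⁻¹' balancedDomain h) :=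
  hf.comp (by fun_prop) fun _ ht => ht

/-- A holomorphic function on a balanced domain has homogeneous polynomial components, given by
averages over circles. -/
lemma IsBalancedGauge.exists_isHomogeneous_eval_eq_integral (hh : IsBalancedGauge h)
    {f : (Fin n → ℂ) → ℂ} (hf : DifferentiableOn ℂ f (balancedDomain h)) (d : ℕ) :
    ∃ P : MvPolynomial (Fin n) ℂ, P.IsHomogeneous d ∧ ∀ z ∈ balancedDomain h,
      MvPolynomial.eval z P = (d.factorial : ℂ)⁻¹ * iteratedDeriv d (fun t : ℂ => f (t • z)) 0 ∧
      MvPolynomial.eval z P = ∫ θ, ((circleMap 0 1 θ) ^ d)⁻¹ * f (circleMap 0 1 θ • z)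
        ∂circleParamMeasure := by
  obtain ⟨P, hP, hPe⟩ := exists_isHomogeneous_eval_eq_iteratedDeriv hh.isOpen_balancedDomain
    hh.zero_mem_balancedDomain d hf
  have hd : (d.factorial : ℂ) ≠ 0 := by exact_mod_cast d.factorial_ne_zero
  refine ⟨(d.factorial : ℂ)⁻¹ • P,
    (MvPolynomial.homogeneousSubmodule (Fin n) ℂ d).smul_mem _ hP, fun z hz => ?_⟩
  have h1 : MvPolynomial.eval z ((d.factorial : ℂ)⁻¹ • P)
      = (d.factorial : ℂ)⁻¹ * iteratedDeriv d (fun t : ℂ => f (t • z)) 0 := by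
    rw [MvPolynomial.smul_eval, hPe]
  refine ⟨h1, ?_⟩
  obtain ⟨r, hr, hsub⟩ := hh.exists_ball_subset_preimage hz
  rw [h1, iteratedDeriv_eq_integral_circleParamMeasure (differentiableOn_comp_smul_balancedDomain hf z)
    ((Metric.closedBall_subset_ball hr).trans hsub) d, inv_mul_cancel_left₀ hd]

/-- A holomorphic function on a balanced domain all of whose Taylor coefficients along complex
lines vanish is zero. -/
lemma IsBalancedGauge.eq_zero_of_iteratedDeriv_eq_zero (hh : IsBalancedGauge h)
    {f : (Fin n → ℂ) → ℂ} (hf : DifferentiableOn ℂ f (balancedDomain h)) {z : Fin n → ℂ}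
    (hz : z ∈ balancedDomain h)
    (h0 : ∀ d, iteratedDeriv d (fun t : ℂ => f (t • z)) 0 = 0) : f z = 0 := by
  obtain ⟨r, hr, hsub⟩ := hh.exists_ball_subset_preimage hz
  have := Complex.taylorSeries_eq_on_ball (z := 1) (c := 0) (r := r)
    ((differentiableOn_comp_smul_balancedDomain hf z).mono hsub) (by simpa using hr)
  simpa [h0] using this.symm

lemma norm_integral_sq_le_lintegral {X : Type*} [MeasurableSpace X] {μ : Measure X}
    [IsProbabilityMeasure μ] {g : X → ℂ} (hg : AEStronglyMeasurable g μ) :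
    ‖∫ x, g x ∂μ‖ₑ ^ 2 ≤ ∫⁻ x, ‖g x‖ₑ ^ 2 ∂μ := by
  rw [← eLpNorm_two_sq]
  gcongr
  refine (enorm_integral_le_lintegral_enorm g).trans ?_
  rw [← eLpNorm_one_eq_lintegral_enorm]
  exact eLpNorm_le_eLpNorm_of_exponent_le one_le_two hg

/-- By rotation invariance every slice at fixed `θ` has the `L²` norm of `f`, and `θ` ranges over a
probability space. The indicator supplies joint measurability, since nothing is known about `f` off
`D`. -/
lemma IsBalancedGauge.memLp_indicator_circleMap_smul (hh : IsBalancedGauge h)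
    {f : (Fin n → ℂ) → ℂ} (hf : f ∈ L2Hol (balancedDomain h)) :
    Measurable (fun p : (Fin n → ℂ) × ℝ =>
      (balancedDomain h).indicator f (circleMap 0 1 p.2 • p.1)) ∧
    MemLp (fun p : (Fin n → ℂ) × ℝ => (balancedDomain h).indicator f (circleMap 0 1 p.2 • p.1)) 2
      ((volume.restrict (balancedDomain h)).prod circleParamMeasure) := by
  have hD := hh.isOpen_balancedDomain
  have hm := measurable_indicator_of_continuousOn hD.measurableSet hf.1.continuousOn
  have hmeas : Measurable (fun p : (Fin n → ℂ) × ℝ =>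
      (balancedDomain h).indicator f (circleMap 0 1 p.2 • p.1)) := by
    refine hm.comp (Continuous.measurable ?_)
    have := continuous_circleMap 0 1
    fun_prop
  refine ⟨hmeas, hmeas.aestronglyMeasurable, ?_⟩
  have hsq : ∫⁻ p : (Fin n → ℂ) × ℝ, ‖(balancedDomain h).indicator f (circleMap 0 1 p.2 • p.1)‖ₑ ^ 2
      ∂((volume.restrict (balancedDomain h)).prod circleParamMeasure)
      = eLpNorm f 2 (volume.restrict (balancedDomain h)) ^ 2 := by
    rw [lintegral_prod_symm _ (hmeas.enorm.pow_const 2).aemeasurable]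
    have : ∀ θ, ∫⁻ z in balancedDomain h,
        ‖(balancedDomain h).indicator f (circleMap 0 1 θ • z)‖ₑ ^ 2
        = eLpNorm f 2 (volume.restrict (balancedDomain h)) ^ 2 := fun θ => by
      rw [(hh.measurePreserving_smul (norm_circleMap_zero_one θ)).lintegral_comp
        (f := fun z => ‖(balancedDomain h).indicator f z‖ₑ ^ 2) (hm.enorm.pow_const 2),
        eLpNorm_two_sq]
      exact setLIntegral_congr_fun hD.measurableSet fun z hz => by
        simp only [Set.indicator_of_mem hz]
    simp [this]
  rw [← eLpNorm_two_sq] at hsq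
  have hlt : eLpNorm f 2 (volume.restrict (balancedDomain h)) ^ 2 < ∞ :=
    ENNReal.pow_lt_top hf.2.2
  rw [← hsq] at hlt
  by_contra hne
  rw [not_lt, top_le_iff] at hne
  simp [hne] at hlt

/-- The homogeneous components of a square integrable holomorphic function are square integrable. -/
lemma IsBalancedGauge.mem_sqIntegrablePolynomials (hh : IsBalancedGauge h)
    {f : (Fin n → ℂ) → ℂ} (hf : f ∈ L2Hol (balancedDomain h)) {d : ℕ}
    {P : MvPolynomial (Fin n) ℂ} (hP : P.IsHomogeneous d)
    (hPe : ∀ z ∈ balancedDomain h, MvPolynomial.eval z P =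
      ∫ θ, ((circleMap 0 1 θ) ^ d)⁻¹ * f (circleMap 0 1 θ • z) ∂circleParamMeasure) :
    P ∈ sqIntegrablePolynomials (balancedDomain h) d := by
  have hD := hh.isOpen_balancedDomain
  obtain ⟨hm, hL⟩ := hh.memLp_indicator_circleMap_smul hf
  refine ⟨hP, P.differentiable_eval.continuous.aestronglyMeasurable, ?_⟩
  have hsq : eLpNorm (fun z => MvPolynomial.eval z P) 2 (volume.restrict (balancedDomain h)) ^ 2
      ≤ eLpNorm (fun p : (Fin n → ℂ) × ℝ =>
        (balancedDomain h).indicator f (circleMap 0 1 p.2 • p.1)) 2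
        ((volume.restrict (balancedDomain h)).prod circleParamMeasure) ^ 2 := by
    rw [eLpNorm_two_sq, eLpNorm_two_sq, lintegral_prod _ (hm.enorm.pow_const 2).aemeasurable]
    refine setLIntegral_mono' hD.measurableSet fun z hz => ?_
    have hz' : ∀ θ, circleMap 0 1 θ • z ∈ balancedDomain h := fun θ =>
      hh.smul_mem_balancedDomain (norm_circleMap_zero_one θ).le hz
    have h1 : MvPolynomial.eval z P = ∫ θ, ((circleMap 0 1 θ) ^ d)⁻¹ *
        (balancedDomain h).indicator f (circleMap 0 1 θ • z) ∂circleParamMeasure := by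
      rw [hPe z hz]
      congr 1
      funext θ
      rw [Set.indicator_of_mem (hz' θ)]
    rw [h1]
    refine (norm_integral_sq_le_lintegral ?_).trans_eq ?_
    · have hmz : Measurable fun θ : ℝ =>
          (balancedDomain h).indicator f (circleMap 0 1 θ • z) :=
        (measurable_indicator_of_continuousOn hD.measurableSet hf.1.continuousOn).comp
          (Continuous.measurable ((continuous_circleMap 0 1).smul continuous_const))
      exact (((measurable_circleMap 0 1).pow_const d).inv.mul hmz).aestronglyMeasurable
    · refine lintegral_congr fun θ => ?_
      rw [enorm_mul, ← ofReal_norm, norm_inv, norm_pow, norm_circleMap_zero_one]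
      simp
  by_contra hne
  rw [not_lt, top_le_iff] at hne
  rw [hne] at hsq
  have := hsq.trans_lt (ENNReal.pow_lt_top hL.2)
  simp at this

/-- Pairing with a homogeneous component is the same as pairing the components. -/
lemma IsBalancedGauge.integral_conj_eval_mul (hh : IsBalancedGauge h)
    {f : (Fin n → ℂ) → ℂ} (hf : f ∈ L2Hol (balancedDomain h)) {d : ℕ}
    {P : MvPolynomial (Fin n) ℂ} (hP : P ∈ sqIntegrablePolynomials (balancedDomain h) d)
    (hPe : ∀ z ∈ balancedDomain h, MvPolynomial.eval z P =
      ∫ θ, ((circleMap 0 1 θ) ^ d)⁻¹ * f (circleMap 0 1 θ • z) ∂circleParamMeasure) :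
    ∫ z in balancedDomain h, starRingEnd ℂ (MvPolynomial.eval z P) * f z
      = ∫ z in balancedDomain h,
          starRingEnd ℂ (MvPolynomial.eval z P) * MvPolynomial.eval z P := by
  have hD := hh.isOpen_balancedDomain
  obtain ⟨hm, hL⟩ := hh.memLp_indicator_circleMap_smul hf
  set G : (Fin n → ℂ) → ℝ → ℂ := fun z θ => starRingEnd ℂ (MvPolynomial.eval z P) *
    (((circleMap 0 1 θ) ^ d)⁻¹ * (balancedDomain h).indicator f (circleMap 0 1 θ • z)) with hG
  have hint : Integrable (Function.uncurry G)
      ((volume.restrict (balancedDomain h)).prod circleParamMeasure) := by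
    have hA : MemLp (fun p : (Fin n → ℂ) × ℝ => starRingEnd ℂ (MvPolynomial.eval p.1 P)) 2
        ((volume.restrict (balancedDomain h)).prod circleParamMeasure) :=
      (hP.2.star).comp_fst circleParamMeasure
    have hB : MemLp (fun p : (Fin n → ℂ) × ℝ => ((circleMap 0 1 p.2) ^ d)⁻¹ *
        (balancedDomain h).indicator f (circleMap 0 1 p.2 • p.1)) 2
        ((volume.restrict (balancedDomain h)).prod circleParamMeasure) := by
      refine hL.of_le ?_ (ae_of_all _ fun p => ?_)
      · exact ((((measurable_circleMap 0 1).comp measurable_snd).pow_const d).inv.mul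
          hm).aestronglyMeasurable
      · rw [norm_mul, norm_inv, norm_pow, norm_circleMap_zero_one]
        simp
    exact hA.integrable_mul hB
  -- After rotating the variable, the factor `conj (c ^ d)` from the homogeneity of `P` is exactly
  -- the `c ^ (-d)` in the Cauchy kernel, because `|c| = 1`.
  have hinner : ∀ θ, ∫ z in balancedDomain h, G z θ
      = ∫ z in balancedDomain h, starRingEnd ℂ (MvPolynomial.eval z P) * f z := by
    intro θ
    have hc := norm_circleMap_zero_one θ
    rw [← hh.setIntegral_comp_smul hc fun z => starRingEnd ℂ (MvPolynomial.eval z P) * f z]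
    refine setIntegral_congr_fun hD.measurableSet fun z hz => ?_
    simp only [hG, hP.1.eval_smul, map_mul, map_pow,
      Set.indicator_of_mem (hh.smul_mem_balancedDomain hc.le hz)]
    rw [← inv_pow, Complex.inv_eq_conj hc]
    ring
  have hswap := integral_integral_swap hint
  have hleft : ∫ z in balancedDomain h, ∫ θ, G z θ ∂circleParamMeasure = ∫ z in balancedDomain h,
      starRingEnd ℂ (MvPolynomial.eval z P) * MvPolynomial.eval z P := by
    refine setIntegral_congr_fun hD.measurableSet fun z hz => ?_
    simp only [hG]
    rw [integral_const_mul]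
    congr 1
    rw [hPe z hz]
    exact integral_congr_ae (ae_of_all _ fun θ => by
      simp only [Set.indicator_of_mem (hh.smul_mem_balancedDomain (norm_circleMap_zero_one θ).le hz)])
  rw [← hleft, hswap]
  simp [hinner]

/-- An element of the Bergman space orthogonal to all homogeneous parts vanishes. -/
lemma IsBalancedGauge.eq_zero_of_forall_inner_eq_zero (hh : IsBalancedGauge h)
    {F : bergmanSpace (balancedDomain h)}
    (hF : ∀ d, ∀ G ∈ bergmanHomogeneousPart (balancedDomain h) d, inner ℂ G F = 0) : F = 0 := by
  have hD := hh.isOpen_balancedDomain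
  have hf := bergmanRep_mem F
  have hzero : ∀ z ∈ balancedDomain h, bergmanRep F z = 0 := by
    intro z hz
    refine hh.eq_zero_of_iteratedDeriv_eq_zero hf.1 hz fun d => ?_
    obtain ⟨P, hP, hPe⟩ := hh.exists_isHomogeneous_eval_eq_integral hf.1 d
    have hPS := hh.mem_sqIntegrablePolynomials hf hP fun z hz => (hPe z hz).2
    set G := polynomialToBergman (balancedDomain h) d ⟨P, hPS⟩
    have hGe : Set.EqOn (bergmanRep G) (fun z => MvPolynomial.eval z P) (balancedDomain h) :=
      bergmanRep_mk hD (eval_mem_L2Hol hPS)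
    have h1 := hF d G ⟨_, rfl⟩
    -- The degree-`d` component `G` of `F` is its orthogonal projection, so orthogonality of `F` to
    -- `G` makes `G` vanish.
    have h2 : inner ℂ G G = inner ℂ G F := by
      rw [inner_bergmanSpace, inner_bergmanSpace]
      have := hh.integral_conj_eval_mul hf hPS fun z hz => (hPe z hz).2
      rw [setIntegral_congr_fun hD.measurableSet (g := fun z =>
        starRingEnd ℂ (MvPolynomial.eval z P) * MvPolynomial.eval z P)
        fun z hz => by simp only [hGe hz], ← this]
      exact setIntegral_congr_fun hD.measurableSet fun z hz => by simp only [hGe hz]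
    rw [h1, inner_self_eq_zero] at h2
    have h3 : MvPolynomial.eval z P = 0 := by
      refine (hGe hz).symm.trans ?_
      rw [h2]
      exact map_zero (bergmanEval hD hz)
    have h4 := (hPe z hz).1
    rw [h3, eq_comm, mul_eq_zero] at h4
    exact h4.resolve_left (inv_ne_zero (by exact_mod_cast d.factorial_ne_zero))
  refine Subtype.ext (Lp.ext ?_)
  filter_upwards [coeFn_ae_eq_bergmanRep F, ae_restrict_mem hD.measurableSet,
    Lp.coeFn_zero ℂ 2 (volume.restrict (balancedDomain h))] with z h1 h2 h3
  rw [h1, hzero z h2]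
  exact h3.symm

/-- The Bergman space of a balanced domain has an orthonormal basis of homogeneous polynomials. -/
theorem IsBalancedGauge.exists_isHomogeneousOrthonormalBasis (hh : IsBalancedGauge h) :
    ∃ (k : ℕ → ℕ) (Q : (d : ℕ) → Fin (k d) → MvPolynomial (Fin n) ℂ),
      IsHomogeneousOrthonormalBasis (balancedDomain h) k Q := by
  have hD := hh.isOpen_balancedDomain
  have := completeSpace_bergmanSpace hD
  set v : ∀ d, OrthonormalBasis (Fin (Module.finrank ℂ (bergmanHomogeneousPart
      (balancedDomain h) d))) ℂ (bergmanHomogeneousPart (balancedDomain h) d) :=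
    fun d => stdOrthonormalBasis ℂ (bergmanHomogeneousPart (balancedDomain h) d)
  have hon : Orthonormal ℂ fun a : Σ d, Fin (Module.finrank ℂ (bergmanHomogeneousPart
      (balancedDomain h) d)) => (v a.1 a.2 : bergmanSpace (balancedDomain h)) := by
    refine ⟨fun a => (v a.1).orthonormal.1 a.2, ?_⟩
    rintro ⟨d, i⟩ ⟨e, j⟩ hne
    rcases eq_or_ne d e with rfl | hde
    · exact (v d).orthonormal.2 fun (hij : i = j) => hne (by subst hij; rfl)
    · exact hh.inner_eq_zero_of_ne hde (v d i).2 (v e j).2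
  choose Q hQ hQe using fun (d : ℕ) (j : Fin (Module.finrank ℂ
      (bergmanHomogeneousPart (balancedDomain h) d))) =>
    exists_eval_eq_of_mem_bergmanHomogeneousPart hD (v d j).2
  refine ⟨fun d => Module.finrank ℂ (bergmanHomogeneousPart (balancedDomain h) d), Q, hQ,
    HilbertBasis.mkOfOrthogonalEqBot hon ?_, fun d j => ?_⟩
  · rw [Submodule.eq_bot_iff]
    intro F hF
    refine hh.eq_zero_of_forall_inner_eq_zero fun d G hG => ?_
    rw [Submodule.mem_orthogonal] at hF
    have hexp := (v d).sum_repr ⟨G, hG⟩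
    have : G = ∑ j, (v d).repr ⟨G, hG⟩ j • (v d j : bergmanSpace (balancedDomain h)) := by
      simpa using (congrArg Subtype.val hexp).symm
    rw [this, sum_inner]
    refine Finset.sum_eq_zero fun j _ => ?_
    refine (inner_smul_left (𝕜 := ℂ) (E := bergmanSpace (balancedDomain h))
      (v d j) F ((v d).repr ⟨G, hG⟩ j)).trans ?_
    rw [hF _ (Submodule.subset_span ⟨⟨d, j⟩, rfl⟩), mul_zero]
  · rw [HilbertBasis.coe_mkOfOrthogonalEqBot]
    refine (coeFn_ae_eq_bergmanRep _).trans ?_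
    filter_upwards [ae_restrict_mem hD.measurableSet] with z hz
    exact hQe d j z hz

end Density

/-! ### Radius functions and upper semicontinuous regularization. -/

section RadiusFunctions

variable {n : ℕ}

/-- Constant factors are harmless under `d`-th roots. Passing to `max K 1` gives roots that tend to
`1` even when `K = 0`. -/
lemma limsup_rpow_inv_mul_le {K : ℝ≥0∞} (hK : K ≠ ∞) (u : ℕ → ℝ≥0∞) {c : ℝ} (hc : 0 ≤ c) :
    limsup (fun d : ℕ => K ^ (1 / (c * (d : ℝ))) * u d) atTop ≤ limsup u atTop := by
  have hlim : Tendsto (fun d : ℕ => (max K 1) ^ (1 / (c * (d : ℝ)))) atTop (𝓝 1) := by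
    have h0 : Tendsto (fun d : ℕ => 1 / (c * (d : ℝ))) atTop (𝓝 0) := by
      have := (tendsto_const_div_atTop_nhds_zero_nat (1 / c))
      refine this.congr fun d => ?_
      rw [div_div]
    obtain ⟨L, hL⟩ : ∃ L : ℝ≥0, (L : ℝ≥0∞) = max K 1 :=
      ⟨(max K 1).toNNReal, ENNReal.coe_toNNReal (by simp [hK])⟩
    have hL0 : L ≠ 0 := by
      rintro rfl
      have : (1 : ℝ≥0∞) ≤ 0 := by rw [← ENNReal.coe_zero, hL]; exact le_max_right _ _
      simp at this
    rw [← hL]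
    have h1 : Tendsto (fun d : ℕ => L ^ (1 / (c * (d : ℝ)))) atTop (𝓝 (L ^ (0 : ℝ))) :=
      tendsto_const_nhds.nnrpow h0 (Or.inl hL0)
    rw [NNReal.rpow_zero] at h1
    have h2 := ENNReal.tendsto_coe.2 h1
    simpa [ENNReal.coe_rpow_of_ne_zero hL0] using h2
  calc limsup (fun d : ℕ => K ^ (1 / (c * (d : ℝ))) * u d) atTop
      ≤ limsup ((fun d : ℕ => (max K 1) ^ (1 / (c * (d : ℝ)))) * u) atTop := by
        refine limsup_le_limsup (Eventually.of_forall fun d => ?_)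
        simp only [Pi.mul_apply]
        gcongr
        exact le_max_left _ _
    _ ≤ limsup (fun d : ℕ => (max K 1) ^ (1 / (c * (d : ℝ)))) atTop * limsup u atTop :=
        ENNReal.limsup_mul_le' (Or.inl (by rw [hlim.limsup_eq]; simp))
          (Or.inl (by rw [hlim.limsup_eq]; simp))
    _ = limsup u atTop := by rw [hlim.limsup_eq, one_mul]

variable {k : ℕ → ℕ} {Q : (d : ℕ) → Fin (k d) → MvPolynomial (Fin n) ℂ}

lemma bergmanRadiusFn_smul (hQ : ∀ d j, (Q d j).IsHomogeneous d) (c : ℂ) (z : Fin n → ℂ) :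
    bergmanRadiusFn k Q (c • z) = ‖c‖ₑ * bergmanRadiusFn k Q z := by
  rw [bergmanRadiusFn, bergmanRadiusFn, ← ENNReal.limsup_const_mul_of_ne_top enorm_ne_top]
  refine limsup_congr ?_
  filter_upwards [eventually_gt_atTop 0] with d hd
  have h1 : ∑ j, ‖MvPolynomial.eval (c • z) (Q d j)‖ₑ ^ 2
      = ‖c‖ₑ ^ (2 * (d : ℝ)) * ∑ j, ‖MvPolynomial.eval z (Q d j)‖ₑ ^ 2 := by
    rw [Finset.mul_sum]
    refine Finset.sum_congr rfl fun j _ => ?_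
    rw [(hQ d j).eval_smul, enorm_mul, enorm_pow, mul_pow, ← pow_mul, mul_comm d 2,
      ← ENNReal.rpow_natCast]
    push_cast
    rfl
  have hd' : (2 * (d : ℝ)) ≠ 0 := by positivity
  rw [h1, ENNReal.mul_rpow_of_nonneg _ _ (by positivity), ← ENNReal.rpow_mul,
    mul_one_div_cancel hd', ENNReal.rpow_one]

lemma uscRegularization_smul {u : (Fin n → ℂ) → ℝ≥0∞} {c : ℂ} (hc : c ≠ 0)
    (hu : ∀ z, u (c • z) = ‖c‖ₑ * u z) (z : Fin n → ℂ) :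
    uscRegularization u (c • z) = ‖c‖ₑ * uscRegularization u z := by
  have hmap : map (fun w : Fin n → ℂ => c • w) (𝓝 z) = 𝓝 (c • z) :=
    (Homeomorph.smulOfNeZero c hc).map_nhds_eq z
  rw [uscRegularization, uscRegularization, ← hmap, ← ENNReal.limsup_const_mul_of_ne_top enorm_ne_top]
  change limsup (u ∘ fun w => c • w) (𝓝 z) = _
  congr 1
  ext w
  exact hu w

lemma isOpen_uscRegularization_lt (u : (Fin n → ℂ) → ℝ≥0∞) (c : ℝ≥0∞) :
    IsOpen {z | uscRegularization u z < c} := by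
  rw [isOpen_iff_mem_nhds]
  intro z hz
  obtain ⟨q, hq, hqc⟩ := exists_between (show uscRegularization u z < c from hz)
  have h1 : ∀ᶠ w in 𝓝 z, u w < q := eventually_lt_of_limsup_lt hq
  filter_upwards [eventually_eventually_nhds.2 h1] with w hw
  exact (limsup_le_of_le (by isBoundedDefault) (hw.mono fun _ h => h.le)).trans_lt hqc

lemma uscRegularization_mono {u v : (Fin n → ℂ) → ℝ≥0∞} (huv : ∀ z, u z ≤ v z) (z : Fin n → ℂ) :
    uscRegularization u z ≤ uscRegularization v z :=
  limsup_le_limsup (Eventually.of_forall huv)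

lemma IsBalancedGauge.uscRegularization_le {h : (Fin n → ℂ) → ℝ≥0} (hh : IsBalancedGauge h)
    {u : (Fin n → ℂ) → ℝ≥0∞} (hu : ∀ z, u z ≤ h z) (z : Fin n → ℂ) :
    uscRegularization u z ≤ h z := by
  refine le_of_forall_gt_imp_ge_of_dense fun q hq => ?_
  obtain ⟨p, hp, hpq⟩ := ENNReal.lt_iff_exists_nnreal_btwn.1 hq
  refine (limsup_le_of_le (by isBoundedDefault) ?_).trans hpq.le
  filter_upwards [hh.upperSemicontinuous z p (by exact_mod_cast hp)] with w hw
  exact (hu w).trans (by exact_mod_cast hw.le)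

end RadiusFunctions

/-! ### Expansion in the orthonormal basis and the kernel sums. -/

section BasisExpansion

variable {n : ℕ} {D : Set (Fin n → ℂ)} {k : ℕ → ℕ}
  {Q : (d : ℕ) → Fin (k d) → MvPolynomial (Fin n) ℂ}

/-- The homogeneous component of degree `d` with coefficients `c` in the family `Q`. -/
noncomputable def basisComponent (Q : (d : ℕ) → Fin (k d) → MvPolynomial (Fin n) ℂ)
    (c : (Σ d, Fin (k d)) → ℂ) (d : ℕ) : MvPolynomial (Fin n) ℂ :=
  ∑ j, MvPolynomial.C (c ⟨d, j⟩) * Q d j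

lemma eval_basisComponent (c : (Σ d, Fin (k d)) → ℂ) (d : ℕ) (z : Fin n → ℂ) :
    MvPolynomial.eval z (basisComponent Q c d) = ∑ j, c ⟨d, j⟩ * MvPolynomial.eval z (Q d j) := by
  simp [basisComponent]

lemma isHomogeneous_basisComponent (hQ : ∀ d j, (Q d j).IsHomogeneous d)
    (c : (Σ d, Fin (k d)) → ℂ) (d : ℕ) : (basisComponent Q c d).IsHomogeneous d :=
  MvPolynomial.IsHomogeneous.sum _ _ _ fun j _ => by
    simpa using (MvPolynomial.isHomogeneous_C (Fin n) (c ⟨d, j⟩)).mul (hQ d j)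

variable (b : HilbertBasis (Σ d, Fin (k d)) ℂ (bergmanSpace D))

lemma sum_norm_repr_sq_le (F : bergmanSpace D) (d : ℕ) :
    ∑ j, ‖b.repr F ⟨d, j⟩‖ ^ 2 ≤ ‖F‖ ^ 2 := by
  have hon : Orthonormal ℂ fun j : Fin (k d) => b ⟨d, j⟩ :=
    b.orthonormal.comp (fun j => (⟨d, j⟩ : Σ d, Fin (k d))) (fun i j hij => by simpa using hij)
  simpa [b.repr_apply_apply] using hon.sum_inner_products_le (x := F) (s := Finset.univ)

/-- The sum `∑_j |Q_{d,j}(z)|²`. -/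
noncomputable def homogeneousKernel (Q : (d : ℕ) → Fin (k d) → MvPolynomial (Fin n) ℂ) (d : ℕ)
    (z : Fin n → ℂ) : ℝ := ∑ j, ‖MvPolynomial.eval z (Q d j)‖ ^ 2

lemma homogeneousKernel_nonneg (d : ℕ) (z : Fin n → ℂ) : 0 ≤ homogeneousKernel Q d z :=
  Finset.sum_nonneg fun _ _ => by positivity

lemma ofReal_homogeneousKernel (d : ℕ) (z : Fin n → ℂ) :
    ∑ j, ‖MvPolynomial.eval z (Q d j)‖ₑ ^ 2 = ENNReal.ofReal (homogeneousKernel Q d z) := by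
  rw [homogeneousKernel, ENNReal.ofReal_sum_of_nonneg fun _ _ => by positivity]
  refine Finset.sum_congr rfl fun j _ => ?_
  rw [ENNReal.ofReal_pow (norm_nonneg _), ofReal_norm]

/-- Cauchy–Schwarz for the sum over `j`, with Bessel's inequality for the coefficients. -/
lemma norm_eval_basisComponent_le (F : bergmanSpace D) (d : ℕ) (z : Fin n → ℂ) :
    ‖MvPolynomial.eval z (basisComponent Q (b.repr F) d)‖
      ≤ ‖F‖ * Real.sqrt (homogeneousKernel Q d z) := by
  rw [eval_basisComponent]
  calc _ ≤ ∑ j, ‖b.repr F ⟨d, j⟩‖ * ‖MvPolynomial.eval z (Q d j)‖ :=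
        (norm_sum_le _ _).trans_eq (Finset.sum_congr rfl fun j _ => norm_mul _ _)
    _ ≤ Real.sqrt (∑ j, ‖b.repr F ⟨d, j⟩‖ ^ 2) * Real.sqrt (homogeneousKernel Q d z) :=
        Real.sum_mul_le_sqrt_mul_sqrt _ _ _
    _ ≤ ‖F‖ * Real.sqrt (homogeneousKernel Q d z) := by
        gcongr
        exact Real.sqrt_le_iff.2 ⟨norm_nonneg _, sum_norm_repr_sq_le b F d⟩

/-- A bounded functional that evaluates the basis polynomials at `z` bounds the kernel at `z`. -/
lemma homogeneousKernel_le_sq {z : Fin n → ℂ} {C : ℝ} (L : bergmanSpace D →ₗ[ℂ] ℂ)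
    (d : ℕ) (hC : ∀ F, ‖L F‖ ≤ C * ‖F‖) (hL : ∀ j, L (b ⟨d, j⟩) = MvPolynomial.eval z (Q d j)) :
    homogeneousKernel Q d z ≤ C ^ 2 := by
  set S := homogeneousKernel Q d z with hS
  have hS0 : 0 ≤ S := homogeneousKernel_nonneg d z
  have hon : Orthonormal ℂ fun j : Fin (k d) => b ⟨d, j⟩ :=
    b.orthonormal.comp (fun j => (⟨d, j⟩ : Σ d, Fin (k d))) (fun i j hij => by simpa using hij)
  -- The extremal vector: `L F` and `‖F‖ ^ 2` both equal the kernel `S`, so `S ≤ C * ‖F‖` becomes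
  -- `‖F‖ ≤ C`.
  set F : bergmanSpace D := ∑ j, starRingEnd ℂ (MvPolynomial.eval z (Q d j)) • b ⟨d, j⟩ with hF
  have hLF : L F = S := by
    rw [hF, map_sum, hS, homogeneousKernel, Complex.ofReal_sum]
    refine Finset.sum_congr rfl fun j _ => ?_
    rw [map_smul, hL, smul_eq_mul, ← Complex.normSq_eq_conj_mul_self, Complex.normSq_eq_norm_sq]
  have hFn : ‖F‖ ^ 2 = S := by
    have h1 : inner ℂ F F = (S : ℂ) := by
      refine (hon.inner_sum _ _ Finset.univ).trans ?_
      rw [hS, homogeneousKernel, Complex.ofReal_sum]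
      refine Finset.sum_congr rfl fun j _ => ?_
      rw [mul_comm, ← Complex.normSq_eq_norm_sq, Complex.normSq_eq_conj_mul_self]
      simp [mul_comm]
    have h2 : ((‖F‖ ^ 2 : ℝ) : ℂ) = (S : ℂ) := by
      rw [← h1]
      push_cast
      exact (inner_self_eq_norm_sq_to_K F).symm
    exact_mod_cast h2
  have h3 := hC F
  rw [hLF, Complex.norm_of_nonneg hS0] at h3
  rcases hS0.eq_or_lt with h0 | h0
  · rw [← h0]; positivity
  · have hF0 : 0 < ‖F‖ := by
      rcases (norm_nonneg F).eq_or_lt with h | h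
      · rw [← h] at hFn; norm_num at hFn; linarith
      · exact h
    have h4 : ‖F‖ ≤ C := by
      rw [← hFn, pow_two] at h3
      exact le_of_mul_le_mul_right h3 hF0
    rw [← hFn]
    gcongr

lemma expansionRadiusFn_basisComponent_le (F : bergmanSpace D) (z : Fin n → ℂ) :
    expansionRadiusFn (basisComponent Q (b.repr F)) z ≤ bergmanRadiusFn k Q z := by
  refine le_trans ?_ (limsup_rpow_inv_mul_le (K := ‖F‖ₑ) enorm_ne_top _ zero_le_one)
  refine limsup_le_limsup (Eventually.of_forall fun d => ?_)
  have h1 : ‖MvPolynomial.eval z (basisComponent Q (b.repr F) d)‖ₑ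
      ≤ ‖F‖ₑ * (∑ j, ‖MvPolynomial.eval z (Q d j)‖ₑ ^ 2) ^ (1 / 2 : ℝ) := by
    rw [ofReal_homogeneousKernel, ← ofReal_norm, ← ofReal_norm,
      ENNReal.ofReal_rpow_of_nonneg (homogeneousKernel_nonneg d z) (by positivity),
      ← Real.sqrt_eq_rpow, ← ENNReal.ofReal_mul (norm_nonneg _)]
    exact ENNReal.ofReal_le_ofReal (norm_eval_basisComponent_le b F d z)
  calc ‖MvPolynomial.eval z (basisComponent Q (b.repr F) d)‖ₑ ^ (1 / (d : ℝ))
      ≤ (‖F‖ₑ * (∑ j, ‖MvPolynomial.eval z (Q d j)‖ₑ ^ 2) ^ (1 / 2 : ℝ)) ^ (1 / (d : ℝ)) := by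
        gcongr
    _ = _ := by
        rw [ENNReal.mul_rpow_of_nonneg _ _ (by positivity), ← ENNReal.rpow_mul]
        simp only [one_mul]
        congr 2
        ring

/-- The Hilbert basis expansion converges in norm, evaluation at `z` is continuous, and the terms
are then grouped by degree. -/
lemma hasSum_eval_basisComponent (hD : IsOpen D)
    (hb : ∀ d j, (b ⟨d, j⟩ : Lp ℂ 2 ((volume : Measure (Fin n → ℂ)).restrict D))
      =ᵐ[volume.restrict D] fun z => MvPolynomial.eval z (Q d j))
    (F : bergmanSpace D) {z : Fin n → ℂ} (hz : z ∈ D) :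
    HasSum (fun d => MvPolynomial.eval z (basisComponent Q (b.repr F) d)) (bergmanRep F z) := by
  have h1 := (b.hasSum_repr F).mapL (bergmanEval hD hz)
  refine HasSum.sigma h1 fun d => ?_
  rw [eval_basisComponent]
  have h2 : ∀ j, bergmanEval hD hz (b.repr F ⟨d, j⟩ • b ⟨d, j⟩)
      = b.repr F ⟨d, j⟩ * MvPolynomial.eval z (Q d j) := fun j => by
    rw [map_smul, bergmanEval_apply, smul_eq_mul,
      bergmanRep_eqOn hD (Q d j).differentiable_eval.differentiableOn (hb d j) hz]
  simp only [h2]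
  exact hasSum_fintype _

end BasisExpansion

/-! ### Uniqueness of the homogeneous expansion. -/

section Uniqueness

variable {n : ℕ} {h : (Fin n → ℂ) → ℝ≥0}

/-- Taylor coefficients of a locally uniformly convergent power series. -/
lemma eq_iteratedDeriv_of_tendstoLocallyUniformlyOn {S : Set ℂ} (hS : IsOpen S)
    (h0 : (0 : ℂ) ∈ S) {a : ℕ → ℂ} {g : ℂ → ℂ}
    (hg : TendstoLocallyUniformlyOn (fun (N : ℕ) t => ∑ d ∈ Finset.range N, a d * t ^ d) g atTop S)
    (m : ℕ) : a m * m.factorial = iteratedDeriv m g 0 := by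
  have hcd : ∀ N : ℕ, ContDiff ℂ ⊤ fun t : ℂ => ∑ d ∈ Finset.range N, a d * t ^ d := fun N => by
    fun_prop
  have hlim : TendstoLocallyUniformlyOn
      (fun (N : ℕ) => iteratedDeriv m fun t => ∑ d ∈ Finset.range N, a d * t ^ d)
      (iteratedDeriv m g) atTop S := by
    induction m with
    | zero => simpa using hg
    | succ m ih =>
      simp only [iteratedDeriv_succ]
      refine ih.deriv (Eventually.of_forall fun N => ?_) hS
      exact ((hcd N).differentiable_iteratedDeriv m (by exact_mod_cast WithTop.coe_lt_top _)).differentiableOn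
  have hconst : ∀ᶠ N : ℕ in atTop,
      iteratedDeriv m (fun t : ℂ => ∑ d ∈ Finset.range N, a d * t ^ d) 0 = a m * m.factorial := by
    filter_upwards [eventually_gt_atTop m] with N hN
    rw [iteratedDeriv_fun_sum fun d _ => by fun_prop]
    rw [Finset.sum_eq_single m]
    · rw [iteratedDeriv_const_mul_field, iteratedDeriv_fun_pow_zero]
      simp
    · intro d _ hd
      rw [iteratedDeriv_const_mul_field, iteratedDeriv_fun_pow_zero]
      simp [hd.symm]
    · intro hm
      simp [hN] at hm
  exact tendsto_nhds_unique (tendsto_const_nhds.congr' (hconst.mono fun _ h => h.symm))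
    (hlim.tendsto_at h0)

/-- The homogeneous expansion is unique. -/
lemma IsBalancedGauge.eval_eq_of_isHomogeneousExpansion (hh : IsBalancedGauge h)
    {f : (Fin n → ℂ) → ℂ} {P P' : ℕ → MvPolynomial (Fin n) ℂ}
    (hP : IsHomogeneousExpansion (balancedDomain h) f P)
    (hP' : IsHomogeneousExpansion (balancedDomain h) f P') (d : ℕ) (z : Fin n → ℂ) :
    MvPolynomial.eval z (P d) = MvPolynomial.eval z (P' d) := by
  have hD := hh.isOpen_balancedDomain
  have key : ∀ P : ℕ → MvPolynomial (Fin n) ℂ, IsHomogeneousExpansion (balancedDomain h) f P →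
      MvPolynomial.eval z (P d) * d.factorial = iteratedDeriv d (fun t : ℂ => f (t • z)) 0 := by
    intro P hP
    refine eq_iteratedDeriv_of_tendstoLocallyUniformlyOn
      (S := (fun t : ℂ => t • z) ⁻¹' balancedDomain h) (hD.preimage (by fun_prop))
      (by simpa using hh.zero_mem_balancedDomain) ?_ d (a := fun d => MvPolynomial.eval z (P d))
    refine (hP.2.comp (fun t : ℂ => t • z) (fun t ht => ht) (by fun_prop)).congr fun N t _ => ?_
    exact Finset.sum_congr rfl fun d _ => by rw [(hP.1 d).eval_smul, mul_comm]
  have hd : (d.factorial : ℂ) ≠ 0 := by exact_mod_cast d.factorial_ne_zero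
  exact mul_right_cancel₀ hd ((key P hP).trans (key P' hP').symm)

end Uniqueness

/-! ### Comparison of `h` with the Bergman radius function; simultaneous extension. -/

section BasisInBalancedDomain

variable {n : ℕ} {h : (Fin n → ℂ) → ℝ≥0} {k : ℕ → ℕ}
  {Q : (d : ℕ) → Fin (k d) → MvPolynomial (Fin n) ℂ}

lemma bergmanRadiusFn_le_one {z : Fin n → ℂ} {C : ℝ}
    (hC : ∀ d, homogeneousKernel Q d z ≤ C) : bergmanRadiusFn k Q z ≤ 1 := by
  have h1 : bergmanRadiusFn k Q z
      ≤ limsup (fun d : ℕ => (ENNReal.ofReal C) ^ (1 / (2 * (d : ℝ))) * 1) atTop := by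
    refine limsup_le_limsup (Eventually.of_forall fun d => ?_)
    simp only [mul_one]
    rw [ofReal_homogeneousKernel]
    gcongr
    exact hC d
  refine h1.trans ((limsup_rpow_inv_mul_le ENNReal.ofReal_ne_top (fun _ => 1) zero_le_two).trans ?_)
  simp

lemma bergmanRep_basis (hh : IsBalancedGauge h)
    (b : HilbertBasis (Σ d, Fin (k d)) ℂ (bergmanSpace (balancedDomain h)))
    (hb : ∀ d j, (b ⟨d, j⟩ : Lp ℂ 2 ((volume : Measure (Fin n → ℂ)).restrict (balancedDomain h)))
      =ᵐ[volume.restrict (balancedDomain h)] fun z => MvPolynomial.eval z (Q d j))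
    (d : ℕ) (j : Fin (k d)) {z : Fin n → ℂ} (hz : z ∈ balancedDomain h) :
    bergmanRep (b ⟨d, j⟩) z = MvPolynomial.eval z (Q d j) :=
  bergmanRep_eqOn hh.isOpen_balancedDomain (Q d j).differentiable_eval.differentiableOn (hb d j) hz

/-- For `t > h z` the point `z / t` lies in `D`, where evaluation is bounded; this gives `h_BK(z /
t) ≤ 1`, that is, `h_BK(z) ≤ t`. -/
lemma bergmanRadiusFn_le_gauge (hh : IsBalancedGauge h)
    (hQ : ∀ d j, (Q d j).IsHomogeneous d)
    (b : HilbertBasis (Σ d, Fin (k d)) ℂ (bergmanSpace (balancedDomain h)))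
    (hb : ∀ d j, (b ⟨d, j⟩ : Lp ℂ 2 ((volume : Measure (Fin n → ℂ)).restrict (balancedDomain h)))
      =ᵐ[volume.restrict (balancedDomain h)] fun z => MvPolynomial.eval z (Q d j))
    (z : Fin n → ℂ) : bergmanRadiusFn k Q z ≤ h z := by
  have hD := hh.isOpen_balancedDomain
  refine le_of_forall_gt_imp_ge_of_dense fun q hq => ?_
  obtain ⟨t, ht, htq⟩ := ENNReal.lt_iff_exists_nnreal_btwn.1 hq
  refine le_trans ?_ htq.le
  have ht' : h z < t := by exact_mod_cast ht
  have ht0 : 0 < t := lt_of_le_of_lt zero_le ht'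
  have htc : (t : ℂ) ≠ 0 := by exact_mod_cast ht0.ne'
  have hnt : ‖(t : ℂ)‖₊ = t := by ext; simp
  have hz : (t : ℂ)⁻¹ • z ∈ balancedDomain h := by
    simp only [balancedDomain, Set.mem_ofPred_eq, hh.homogeneous, nnnorm_inv, hnt]
    rwa [inv_mul_lt_iff₀ ht0, mul_one]
  have h1 : bergmanRadiusFn k Q ((t : ℂ)⁻¹ • z) ≤ 1 :=
    bergmanRadiusFn_le_one fun d => homogeneousKernel_le_sq b (bergmanEval hD hz).toLinearMap d
      (bergmanEval hD hz).le_opNorm fun j => bergmanRep_basis hh b hb d j hz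
  have h2 : bergmanRadiusFn k Q z = ‖(t : ℂ)‖ₑ * bergmanRadiusFn k Q ((t : ℂ)⁻¹ • z) := by
    rw [← bergmanRadiusFn_smul hQ, smul_inv_smul₀ htc]
  rw [h2, enorm_eq_nnnorm, hnt]
  exact mul_le_of_le_one_right' h1

/-- One condition on the kernel serves all `F`, because `h_BK` dominates every radius function. The
set `U` may leave `D`; this is how all functions get extended at once. -/
lemma tendstoLocallyUniformlyOn_basisComponent (hh : IsBalancedGauge h)
    (hQ : ∀ d j, (Q d j).IsHomogeneous d)
    (b : HilbertBasis (Σ d, Fin (k d)) ℂ (bergmanSpace (balancedDomain h)))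
    (hb : ∀ d j, (b ⟨d, j⟩ : Lp ℂ 2 ((volume : Measure (Fin n → ℂ)).restrict (balancedDomain h)))
      =ᵐ[volume.restrict (balancedDomain h)] fun z => MvPolynomial.eval z (Q d j))
    (F : bergmanSpace (balancedDomain h))
    {U : Set (Fin n → ℂ)}
    (hU : ∀ z ∈ U, ∃ q < (1 : ℝ≥0∞), ∀ᶠ w in 𝓝 z, bergmanRadiusFn k Q w ≤ q) :
    TendstoLocallyUniformlyOn
      (fun (N : ℕ) (z : Fin n → ℂ) => ∑ d ∈ Finset.range N,
        MvPolynomial.eval z (basisComponent Q (b.repr F) d))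
      (fun z => ∑' d, MvPolynomial.eval z (basisComponent Q (b.repr F) d)) atTop U := by
  have hD := hh.isOpen_balancedDomain
  obtain ⟨r, hr, hrD⟩ := Metric.isOpen_iff.1 hD 0 hh.zero_mem_balancedDomain
  obtain ⟨C, hC0, hC⟩ := exists_norm_bergmanRep_le (balancedDomain h) (half_pos hr)
  have hsub : ∀ y ∈ Metric.ball (0 : Fin n → ℂ) (r / 2),
      Metric.ball y (r / 2) ⊆ balancedDomain h := fun y hy =>
    (Metric.ball_subset_ball' (by rw [Metric.mem_ball] at hy; linarith)).trans hrD
  refine tendstoLocallyUniformlyOn_sum_eval (isHomogeneous_basisComponent hQ _) (half_pos hr)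
    (C := ‖F‖ * C) (fun d z hz => ?_) fun z hz => ?_
  · have hzD : z ∈ balancedDomain h := hsub z hz (Metric.mem_ball_self (half_pos hr))
    refine (norm_eval_basisComponent_le b F d z).trans ?_
    gcongr
    refine Real.sqrt_le_iff.2 ⟨hC0, ?_⟩
    exact homogeneousKernel_le_sq b (bergmanEval hD hzD).toLinearMap d (hC z (hsub z hz))
      fun j => bergmanRep_basis hh b hb d j hzD
  · obtain ⟨q, hq, hev⟩ := hU z hz
    exact ⟨q, hq, hev.mono fun w hw => (expansionRadiusFn_basisComponent_le b F w).trans hw⟩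

lemma isHomogeneousExpansion_basisComponent (hh : IsBalancedGauge h)
    (hQ : ∀ d j, (Q d j).IsHomogeneous d)
    (b : HilbertBasis (Σ d, Fin (k d)) ℂ (bergmanSpace (balancedDomain h)))
    (hb : ∀ d j, (b ⟨d, j⟩ : Lp ℂ 2 ((volume : Measure (Fin n → ℂ)).restrict (balancedDomain h)))
      =ᵐ[volume.restrict (balancedDomain h)] fun z => MvPolynomial.eval z (Q d j))
    (F : bergmanSpace (balancedDomain h)) :
    IsHomogeneousExpansion (balancedDomain h) (bergmanRep F) (basisComponent Q (b.repr F)) := by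
  refine ⟨isHomogeneous_basisComponent hQ _,
    (tendstoLocallyUniformlyOn_basisComponent hh hQ b hb F fun z hz => ?_).congr_right fun z hz => ?_⟩
  · obtain ⟨q, hq, hq1⟩ := exists_between (show h z < 1 from hz)
    refine ⟨q, by exact_mod_cast hq1, ?_⟩
    filter_upwards [hh.upperSemicontinuous z q hq] with w hw
    exact (bergmanRadiusFn_le_gauge hh hQ b hb w).trans (by exact_mod_cast hw.le)
  · exact (hasSum_eval_basisComponent b hh.isOpen_balancedDomain hb F hz).tsum_eq

/-- If `h` is the regularized radius function of one square integrable holomorphic function, it is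
the regularized radius function of the Bergman kernel. -/
lemma eq_uscRegularization_bergmanRadiusFn_of_expansion (hh : IsBalancedGauge h)
    (hQ : ∀ d j, (Q d j).IsHomogeneous d)
    (b : HilbertBasis (Σ d, Fin (k d)) ℂ (bergmanSpace (balancedDomain h)))
    (hb : ∀ d j, (b ⟨d, j⟩ : Lp ℂ 2 ((volume : Measure (Fin n → ℂ)).restrict (balancedDomain h)))
      =ᵐ[volume.restrict (balancedDomain h)] fun z => MvPolynomial.eval z (Q d j))
    {f : (Fin n → ℂ) → ℂ}
    (hf : f ∈ L2Hol (balancedDomain h)) {P : ℕ → MvPolynomial (Fin n) ℂ}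
    (hP : IsHomogeneousExpansion (balancedDomain h) f P)
    (hhP : ∀ z, (h z : ℝ≥0∞) = uscRegularization (expansionRadiusFn P) z) (z : Fin n → ℂ) :
    (h z : ℝ≥0∞) = uscRegularization (bergmanRadiusFn k Q) z := by
  set F := bergmanMk f hf
  have hF : IsHomogeneousExpansion (balancedDomain h) f (basisComponent Q (b.repr F)) :=
    ⟨isHomogeneous_basisComponent hQ _, (isHomogeneousExpansion_basisComponent hh hQ b hb F).2.congr_right
      (bergmanRep_mk hh.isOpen_balancedDomain hf)⟩
  refine le_antisymm ?_ (hh.uscRegularization_le (bergmanRadiusFn_le_gauge hh hQ b hb) z)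
  rw [hhP]
  refine uscRegularization_mono (fun w => ?_) z
  have : expansionRadiusFn P w = expansionRadiusFn (basisComponent Q (b.repr F)) w := by
    simp only [expansionRadiusFn, hh.eval_eq_of_isHomogeneousExpansion hP hF]
  rw [this]
  exact expansionRadiusFn_basisComponent_le b F w

/-- If `D` is an `L²_h`-domain of holomorphy then `h` is the regularized radius function of the
Bergman kernel. -/
lemma eq_uscRegularization_bergmanRadiusFn_of_isDomainOfHolomorphyFor
    (hh : IsBalancedGauge h)
    (hQ : ∀ d j, (Q d j).IsHomogeneous d)
    (b : HilbertBasis (Σ d, Fin (k d)) ℂ (bergmanSpace (balancedDomain h)))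
    (hb : ∀ d j, (b ⟨d, j⟩ : Lp ℂ 2 ((volume : Measure (Fin n → ℂ)).restrict (balancedDomain h)))
      =ᵐ[volume.restrict (balancedDomain h)] fun z => MvPolynomial.eval z (Q d j))
    (hdom : IsDomainOfHolomorphyFor (L2Hol (balancedDomain h)) (balancedDomain h))
    (z : Fin n → ℂ) : (h z : ℝ≥0∞) = uscRegularization (bergmanRadiusFn k Q) z := by
  have hD := hh.isOpen_balancedDomain
  have hle := hh.uscRegularization_le (bergmanRadiusFn_le_gauge hh hQ b hb)
  by_contra hne
  have hlt : uscRegularization (bergmanRadiusFn k Q) z < h z := lt_of_le_of_ne (hle z) (Ne.symm hne)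
  -- With `s` strictly between `h_BK*(z)` and `h z`, the point `z / s` lies in the larger domain but
  -- not in `D`.
  obtain ⟨s, hus, hsh⟩ := ENNReal.lt_iff_exists_nnreal_btwn.1 hlt
  set u := uscRegularization (bergmanRadiusFn k Q) with hu
  have hus' : ∀ c : ℂ, c ≠ 0 → ∀ z, u (c • z) = ‖c‖ₑ * u z := fun c hc z =>
    uscRegularization_smul hc (bergmanRadiusFn_smul hQ c) z
  have hs0 : 0 < s := by
    have := zero_le.trans_lt hus
    exact_mod_cast this
  have hsc : (s : ℂ) ≠ 0 := by exact_mod_cast hs0.ne'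
  have hns : ‖(s : ℂ)‖₊ = s := by ext; simp
  set D₁ : Set (Fin n → ℂ) := {z | u z < 1} with hD₁
  have hsub : balancedDomain h ⊆ D₁ := fun w hw => (hle w).trans_lt (by exact_mod_cast hw)
  have hopen : IsOpen D₁ := isOpen_uscRegularization_lt _ _
  refine hdom.2 ⟨balancedDomain h, D₁, hdom.1, ⟨hopen, ?_⟩, fun w hw => ⟨hsub hw, hw⟩, ?_, ?_⟩
  · refine isConnected_of_forall_smul_mem (hsub hh.zero_mem_balancedDomain) fun w hw t ht ht1 => ?_
    rcases ht.eq_or_lt with rfl | ht0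
    · simpa using hsub hh.zero_mem_balancedDomain
    · have h1 : u ((t : ℂ) • w) = ‖(t : ℂ)‖ₑ * u w := hus' t (by exact_mod_cast ht0.ne') w
      change u ((t : ℂ) • w) < 1
      rw [h1]
      refine (mul_le_of_le_one_left' ?_).trans_lt hw
      rw [← ofReal_norm, Complex.norm_of_nonneg ht]
      exact ENNReal.ofReal_le_one.2 ht1
  · intro hcon
    have h1 : (s : ℂ)⁻¹ • z ∈ D₁ := by
      change u ((s : ℂ)⁻¹ • z) < 1
      rw [hus' _ (inv_ne_zero hsc), enorm_eq_nnnorm, nnnorm_inv, hns,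
        ENNReal.coe_inv hs0.ne', mul_comm, ← div_eq_mul_inv]
      refine ENNReal.div_lt_of_lt_mul ?_
      rwa [one_mul]
    have h2 : h ((s : ℂ)⁻¹ • z) < 1 := hcon h1
    rw [hh.homogeneous, nnnorm_inv, hns, inv_mul_lt_iff₀ hs0, mul_one] at h2
    have h3 : s < h z := by exact_mod_cast hsh
    exact lt_asymm h2 h3
  · intro f hf
    set F := bergmanMk f hf
    refine ⟨fun z => ∑' d, MvPolynomial.eval z (basisComponent Q (b.repr F) d), ?_, fun w hw => ?_⟩
    · refine differentiableOn_of_tendstoLocallyUniformlyOn hopen (fun N => ?_)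
        (tendstoLocallyUniformlyOn_basisComponent hh hQ b hb F fun w hw => ?_)
      · exact (Differentiable.fun_sum fun d _ =>
          MvPolynomial.differentiable_eval _).differentiableOn
      · obtain ⟨q, hq, hq1⟩ := exists_between (show u w < 1 from hw)
        exact ⟨q, hq1, (eventually_lt_of_limsup_lt hq).mono fun _ h => h.le⟩
    · exact (hasSum_eval_basisComponent b hD hb F hw).tsum_eq.trans (bergmanRep_mk hD hf hw)

end BasisInBalancedDomain

/-! ### Boundedness of simultaneous extension. -/

section ClosedGraph

variable {n : ℕ}

/-- A compact set that joins two points of a connected open set through its interior. -/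
lemma exists_isCompact_isPreconnected_of_isConnected {D₁ : Set (Fin n → ℂ)} (hD₁ : IsOpen D₁)
    (hc : IsConnected D₁) {z₀ z₁ : Fin n → ℂ} (h₀ : z₀ ∈ D₁) (h₁ : z₁ ∈ D₁) :
    ∃ K U : Set (Fin n → ℂ), IsCompact K ∧ IsOpen U ∧ IsPreconnected U ∧ z₀ ∈ U ∧ z₁ ∈ U ∧
      U ⊆ K ∧ K ⊆ closure U ∧ K ⊆ D₁ := by
  obtain ⟨γ, hγ⟩ := (hD₁.isConnected_iff_isPathConnected.1 hc).joinedIn z₀ h₀ z₁ h₁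
  have hcomp : IsCompact (Set.range γ) := isCompact_range γ.continuous
  obtain ⟨δ, hδ, hsub⟩ := hcomp.exists_cthickening_subset_open hD₁
    (Set.range_subset_iff.2 hγ)
  have hself : Set.range γ ⊆ Metric.thickening δ (Set.range γ) :=
    Metric.self_subset_thickening hδ _
  refine ⟨Metric.cthickening δ (Set.range γ), Metric.thickening δ (Set.range γ),
    hcomp.cthickening, Metric.isOpen_thickening, ?_, hself ⟨0, γ.source⟩, hself ⟨1, γ.target⟩,
    Metric.thickening_subset_cthickening _ _, (closure_thickening hδ _).ge, hsub⟩
  refine isPreconnected_of_forall z₀ fun y hy => ?_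
  obtain ⟨x, hx, hxy⟩ := Metric.mem_thickening_iff.1 hy
  refine ⟨Set.range γ ∪ Metric.ball x δ, Set.union_subset hself fun w hw =>
    Metric.mem_thickening_iff.2 ⟨x, hx, hw⟩, Or.inl ⟨0, γ.source⟩, Or.inr hxy, ?_⟩
  exact IsPreconnected.union x hx (Metric.mem_ball_self hδ)
    (isPreconnected_range γ.continuous) (convex_ball x δ).isPreconnected

/-- If all square integrable holomorphic functions on `D` extend to `D₁`, then evaluating the
extensions at a point of `D₁` is a bounded functional. -/
lemma exists_bounded_extension_functional {D D₀ D₁ : Set (Fin n → ℂ)} (hD : IsOpen D)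
    (hD₀ : IsComplexDomain D₀) (hD₁ : IsComplexDomain D₁) (hsub : D₀ ⊆ D₁ ∩ D)
    (hext : ∀ f ∈ L2Hol D, ∃ g : (Fin n → ℂ) → ℂ, DifferentiableOn ℂ g D₁ ∧ Set.EqOn g f D₀)
    {z₁ : Fin n → ℂ} (hz₁ : z₁ ∈ D₁) :
    ∃ (L : bergmanSpace D →ₗ[ℂ] ℂ) (C : ℝ), (∀ F, ‖L F‖ ≤ C * ‖F‖) ∧
      ∀ (F : bergmanSpace D) (g : (Fin n → ℂ) → ℂ), DifferentiableOn ℂ g D₁ →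
        Set.EqOn g (bergmanRep F) D₀ → L F = g z₁ := by
  have := completeSpace_bergmanSpace hD
  choose ext hextd hexte using fun F : bergmanSpace D => hext (bergmanRep F) (bergmanRep_mem F)
  obtain ⟨z₀, hz₀⟩ := hD₀.2.nonempty
  have hz₀D₁ : z₀ ∈ D₁ := (hsub hz₀).1
  have huniq : ∀ (F : bergmanSpace D) (g : (Fin n → ℂ) → ℂ), DifferentiableOn ℂ g D₁ →
      Set.EqOn g (bergmanRep F) D₀ → Set.EqOn (ext F) g D₁ := fun F g hg hgF =>
    eqOn_of_isPreconnected_of_eventuallyEq hD₁.1 hD₁.2.isPreconnected (hextd F) hg hz₀D₁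
      (((hexte F).trans hgF.symm).eventuallyEq_of_mem (hD₀.1.mem_nhds hz₀))
  -- Restricting extensions to a compact `K` makes the target the Banach space `C(K, ℂ)`. Uniform
  -- limits on `K` are holomorphic on `U`, the identity theorem propagates from `z₀` through the
  -- connected `U`, and density of `U` in `K` carries it to `K`.
  obtain ⟨K, U, hK, hU, hUc, hz₀U, hz₁U, hUK, hKU, hKD₁⟩ :=
    exists_isCompact_isPreconnected_of_isConnected hD₁.1 hD₁.2 hz₀D₁ hz₁
  have : CompactSpace K := isCompact_iff_compactSpace.1 hK
  have hadd : ∀ F G, Set.EqOn (ext (F + G)) (ext F + ext G) D₁ := fun F G =>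
    huniq _ _ ((hextd F).add (hextd G)) fun z hz => by
      rw [bergmanRep_add hD F G (hsub hz).2, Pi.add_apply, hexte F hz, hexte G hz]
  have hsmul : ∀ (c : ℂ) F, Set.EqOn (ext (c • F)) (c • ext F) D₁ := fun c F =>
    huniq _ _ ((hextd F).const_smul c) fun z hz => by
      rw [bergmanRep_smul hD c F (hsub hz).2, Pi.smul_apply, hexte F hz, smul_eq_mul]
  set T : bergmanSpace D →ₗ[ℂ] C(K, ℂ) :=
    { toFun := fun F => ⟨K.domRestrict (ext F), ((hextd F).continuousOn.mono hKD₁).domRestrict⟩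
      map_add' := fun F G => by
        ext x
        exact hadd F G (hKD₁ x.2)
      map_smul' := fun c F => by
        ext x
        exact hsmul c F (hKD₁ x.2) } with hT
  have hTa : ∀ F (x : K), T F x = ext F x := fun F x => rfl
  have hTc : Continuous T := by
    refine T.continuous_of_seq_closed_graph fun u F G hu hTu => ?_
    classical
    set g : (Fin n → ℂ) → ℂ := fun z => if hz : z ∈ K then G ⟨z, hz⟩ else 0 with hg
    have hgK : ∀ z (hz : z ∈ K), g z = G ⟨z, hz⟩ := fun z hz => dif_pos hz
    have hunif : TendstoUniformlyOn (fun k => ext (u k)) g atTop K := by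
      rw [Metric.tendstoUniformlyOn_iff]
      intro ε hε
      filter_upwards [Metric.tendsto_nhds.1 hTu ε hε] with k hk z hz
      rw [hgK z hz, dist_comm]
      exact (ContinuousMap.dist_apply_le_dist (f := T (u k)) (g := G) ⟨z, hz⟩).trans_lt hk
    have hgU : DifferentiableOn ℂ g U :=
      differentiableOn_of_tendstoLocallyUniformlyOn hU
        (fun k => (hextd (u k)).mono (hUK.trans hKD₁))
        (hunif.mono hUK).tendstoLocallyUniformlyOn
    have hev : g =ᶠ[𝓝 z₀] ext F := by
      filter_upwards [hU.mem_nhds hz₀U, hD₀.1.mem_nhds hz₀] with z hzU hzD₀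
      have h1 := hunif.tendsto_at (hUK hzU)
      have h2 : Tendsto (fun k => bergmanRep (u k) z) atTop (𝓝 (bergmanRep F z)) :=
        ((bergmanEval hD (hsub hzD₀).2).continuous.tendsto F).comp hu
      rw [hexte F hzD₀]
      refine tendsto_nhds_unique h1 (h2.congr fun k => (hexte (u k) hzD₀).symm)
    have hEU : Set.EqOn g (ext F) U := eqOn_of_isPreconnected_of_eventuallyEq hU hUc hgU
      ((hextd F).mono (hUK.trans hKD₁)) hz₀U hev
    have hgKc : ContinuousOn g K := by
      rw [continuousOn_iff_continuous_domRestrict]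
      refine G.continuous.congr fun x => ?_
      simp [hgK x x.2]
    have hEK : Set.EqOn g (ext F) K :=
      hEU.of_subset_closure hgKc ((hextd F).continuousOn.mono hKD₁) hUK hKU
    ext x
    rw [hTa, ← hEK x.2, hgK x x.2]
  set T' : bergmanSpace D →L[ℂ] C(K, ℂ) := ⟨T, hTc⟩
  refine ⟨{ toFun := fun F => T F ⟨z₁, hUK hz₁U⟩
            map_add' := fun F G => by rw [map_add]; rfl
            map_smul' := fun c F => by rw [map_smul]; rfl }, ‖T'‖, fun F => ?_, fun F g hg hgF => ?_⟩
  · exact ((T F).norm_coe_le_norm _).trans (T'.le_opNorm F)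
  · exact huniq F g hg hgF hz₁

end ClosedGraph

/-! ### The remaining implications: natural boundary and Baire category. -/

section Implications

variable {n : ℕ} {h : (Fin n → ℂ) → ℝ≥0} {k : ℕ → ℕ}
  {Q : (d : ℕ) → Fin (k d) → MvPolynomial (Fin n) ℂ}

/-- If `h` is the regularized radius function of the Bergman kernel, then `D` is an
`L²_h`-domain of holomorphy. -/
lemma isDomainOfHolomorphyFor_of_eq_uscRegularization (hh : IsBalancedGauge h)
    (b : HilbertBasis (Σ d, Fin (k d)) ℂ (bergmanSpace (balancedDomain h)))
    (hb : ∀ d j, (b ⟨d, j⟩ : Lp ℂ 2 ((volume : Measure (Fin n → ℂ)).restrict (balancedDomain h)))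
      =ᵐ[volume.restrict (balancedDomain h)] fun z => MvPolynomial.eval z (Q d j))
    (hu : ∀ z, (h z : ℝ≥0∞) = uscRegularization (bergmanRadiusFn k Q) z) :
    IsDomainOfHolomorphyFor (L2Hol (balancedDomain h)) (balancedDomain h) := by
  have hD := hh.isOpen_balancedDomain
  refine ⟨hh.isComplexDomain_balancedDomain, ?_⟩
  rintro ⟨D₀, D₁, hD₀, hD₁, hsub, hnot, hext⟩
  have h1 : ∀ z ∈ D₁, bergmanRadiusFn k Q z ≤ 1 := by
    intro z hz
    obtain ⟨L, C, hC, hL⟩ := exists_bounded_extension_functional hD hD₀ hD₁ hsub hext hz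
    exact bergmanRadiusFn_le_one fun d => homogeneousKernel_le_sq b L d hC fun j =>
      hL _ (fun z => MvPolynomial.eval z (Q d j)) (Q d j).differentiable_eval.differentiableOn
        fun w hw => (bergmanRep_basis hh b hb d j (hsub hw).2).symm
  have h2 : ∀ z ∈ D₁, h z ≤ 1 := by
    intro z hz
    have : (h z : ℝ≥0∞) ≤ 1 := by
      rw [hu]
      refine limsup_le_of_le (by isBoundedDefault) ?_
      filter_upwards [hD₁.1.mem_nhds hz] with w hw using h1 w hw
    exact_mod_cast this
  refine hnot fun z hz => ?_
  -- For some `t > 1` the point `t • z` is still in the open set `D₁`, so `h z ≤ 1 / t < 1`.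
  have hev : ∀ᶠ t : ℝ in 𝓝[>] 1, (t : ℂ) • z ∈ D₁ := by
    have hc : Tendsto (fun t : ℝ => (t : ℂ) • z) (𝓝 1) (𝓝 z) := by
      have : Continuous fun t : ℝ => (t : ℂ) • z := by fun_prop
      simpa using this.tendsto 1
    exact (hc.mono_left nhdsWithin_le_nhds).eventually (hD₁.1.mem_nhds hz)
  obtain ⟨t, ht, ht1⟩ := (hev.and self_mem_nhdsWithin).exists
  replace ht1 : 1 < t := ht1
  have h3 := h2 _ ht
  rw [hh.homogeneous] at h3
  have h4 : t * (h z : ℝ) ≤ 1 := by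
    have : ((‖(t : ℂ)‖₊ * h z : ℝ≥0) : ℝ) ≤ 1 := by exact_mod_cast h3
    rwa [NNReal.coe_mul, coe_nnnorm, Complex.norm_of_nonneg (by linarith)] at this
  have h5 : (h z : ℝ) < 1 := by
    by_contra hcon
    rw [not_lt] at hcon
    nlinarith
  exact_mod_cast h5

/-- Evaluation of a homogeneous component as a linear functional. -/
noncomputable def basisComponentEval {D : Set (Fin n → ℂ)}
    (Q : (d : ℕ) → Fin (k d) → MvPolynomial (Fin n) ℂ)
    (b : HilbertBasis (Σ d, Fin (k d)) ℂ (bergmanSpace D)) (d : ℕ) (z : Fin n → ℂ) :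
    bergmanSpace D →ₗ[ℂ] ℂ where
  toFun F := MvPolynomial.eval z (basisComponent Q (b.repr F) d)
  map_add' F G := by
    simp only [eval_basisComponent, map_add, lp.coeFn_add, Pi.add_apply, add_mul,
      Finset.sum_add_distrib]
  map_smul' c F := by
    simp only [eval_basisComponent, map_smul, lp.coeFn_smul, Pi.smul_apply, smul_eq_mul,
      Finset.mul_sum, mul_assoc, RingHom.id_apply]

lemma continuous_basisComponentEval {D : Set (Fin n → ℂ)}
    (b : HilbertBasis (Σ d, Fin (k d)) ℂ (bergmanSpace D)) (d : ℕ) (z : Fin n → ℂ) :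
    Continuous (basisComponentEval Q b d z) := by
  change Continuous fun F => MvPolynomial.eval z (basisComponent Q (b.repr F) d)
  simp only [eval_basisComponent, b.repr_apply_apply]
  exact continuous_finsetSum _ fun j _ => (continuous_const.inner continuous_id).mul continuous_const

lemma basisComponentEval_basis {D : Set (Fin n → ℂ)}
    (b : HilbertBasis (Σ d, Fin (k d)) ℂ (bergmanSpace D)) (d : ℕ) (z : Fin n → ℂ)
    (j : Fin (k d)) :
    basisComponentEval Q b d z (b ⟨d, j⟩) = MvPolynomial.eval z (Q d j) := by
  classical
  change MvPolynomial.eval z (basisComponent Q (b.repr (b ⟨d, j⟩)) d) = _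
  rw [eval_basisComponent, Finset.sum_eq_single j]
  · rw [b.repr_self]; simp
  · intro i _ hij
    rw [b.repr_self, lp.single_apply_ne, zero_mul]
    simpa using hij
  · simp

/-- A bound on a ball around any center is transferred to the origin by linearity: subtracting the
value at the center costs a factor `2`, and a step of length `r / 2` costs another. -/
lemma norm_le_of_norm_le_on_ball {V : Type*} [NormedAddCommGroup V] [NormedSpace ℂ V]
    (L : V →ₗ[ℂ] ℂ) {x₀ : V} {r M : ℝ} (hr : 0 < r) (hM : ∀ x ∈ Metric.ball x₀ r, ‖L x‖ ≤ M)
    (x : V) : ‖L x‖ ≤ 4 * M / r * ‖x‖ := by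
  rcases eq_or_ne x 0 with rfl | hx
  · simp
  have hx0 : 0 < ‖x‖ := norm_pos_iff.2 hx
  set s : ℝ := r / (2 * ‖x‖) with hs
  have hs0 : 0 < s := by positivity
  have h1 : ‖L (x₀ + (s : ℂ) • x)‖ ≤ M := by
    refine hM _ ?_
    rw [Metric.mem_ball, dist_self_add_left, norm_smul, Complex.norm_of_nonneg hs0.le, hs]
    field_simp
    linarith
  have h2 := hM x₀ (Metric.mem_ball_self hr)
  have h3 : s * ‖L x‖ ≤ 2 * M := by
    have : (s : ℂ) * L x = L (x₀ + (s : ℂ) • x) - L x₀ := by simp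
    calc s * ‖L x‖ = ‖(s : ℂ) * L x‖ := by rw [norm_mul, Complex.norm_of_nonneg hs0.le]
      _ ≤ 2 * M := by rw [this]; linarith [norm_sub_le (L (x₀ + (s : ℂ) • x)) (L x₀)]
  calc ‖L x‖ = s⁻¹ * (s * ‖L x‖) := by field_simp
    _ ≤ s⁻¹ * (2 * M) := by gcongr
    _ = 4 * M / r * ‖x‖ := by rw [hs]; field_simp; ring

/-- Condensation of singularities: a generic element of the Bergman space has maximal radius
function. -/
lemma exists_uscRegularization_bergmanRadiusFn_le {D : Set (Fin n → ℂ)} (hD : IsOpen D)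
    (b : HilbertBasis (Σ d, Fin (k d)) ℂ (bergmanSpace D)) :
    ∃ F : bergmanSpace D, ∀ z, uscRegularization (bergmanRadiusFn k Q) z
      ≤ uscRegularization (expansionRadiusFn (basisComponent Q (b.repr F))) z := by
  have := completeSpace_bergmanSpace hD
  set B := TopologicalSpace.countableBasis (Fin n → ℂ)
  have hB : TopologicalSpace.IsTopologicalBasis B := TopologicalSpace.isBasis_countableBasis _
  have : Countable B := (TopologicalSpace.countable_countableBasis _).to_subtype
  -- The regularization at `z` depends only on which levels are exceeded in each basic
  -- neighbourhood, so one test point per basic open set and rational level suffices. Countability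
  -- is what Baire's theorem requires.
  set ι := {p : B × ℚ // 0 < p.2 ∧ ∃ w ∈ p.1.1, ENNReal.ofReal p.2 < bergmanRadiusFn k Q w}
  choose hq0 w hwB hw using fun i : ι => i.2
  have hq : ∀ i : ι, (0 : ℝ) < i.1.2 := fun i => by exact_mod_cast hq0 i
  set bad : ι × ℕ → Set (bergmanSpace D) := fun i =>
    {F | ∀ d, ‖basisComponentEval Q b d (w i.1) F‖ ≤ i.2 * (i.1.1.2 : ℝ) ^ d} with hbad
  have hclosed : ∀ i, IsClosed (bad i) := fun i => by
    have : bad i = ⋂ d, {F | ‖basisComponentEval Q b d (w i.1) F‖ ≤ i.2 * (i.1.1.2 : ℝ) ^ d} := by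
      ext F; simp [hbad]
    rw [this]
    exact isClosed_iInter fun d =>
      isClosed_le (continuous_basisComponentEval b d _).norm continuous_const
  have hint : ∀ i, interior (bad i) = ∅ := by
    intro i
    by_contra hne
    obtain ⟨F₀, hF₀⟩ := Set.nonempty_iff_ne_empty.2 hne
    obtain ⟨r, hr, hball⟩ := Metric.isOpen_iff.1 isOpen_interior F₀ hF₀
    set q : ℝ := ((i.1.1.2 : ℚ) : ℝ)
    have hq' : 0 < q := hq i.1
    -- A ball inside a bad set would bound the component functionals by a constant times `q ^ d`,
    -- hence `h_BK ≤ q` at the test point, against its choice.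
    have hker : ∀ d, homogeneousKernel Q d (w i.1) ≤ (4 * (i.2 * q ^ d) / r) ^ 2 := fun d =>
      homogeneousKernel_le_sq b (basisComponentEval Q b d (w i.1)) d
        (norm_le_of_norm_le_on_ball _ hr fun F hF => interior_subset (hball hF) d)
        (basisComponentEval_basis b d _)
    have hle : bergmanRadiusFn k Q (w i.1) ≤ ENNReal.ofReal q := by
      have h1 : bergmanRadiusFn k Q (w i.1) ≤ limsup (fun d : ℕ =>
          (ENNReal.ofReal ((4 * i.2 / r) ^ 2)) ^ (1 / (2 * (d : ℝ))) * ENNReal.ofReal q) atTop := by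
        refine limsup_le_limsup ?_
        filter_upwards [eventually_gt_atTop 0] with d hd
        have hd' : (2 * (d : ℝ)) ≠ 0 := by positivity
        have e : ENNReal.ofReal ((4 * (i.2 * q ^ d) / r) ^ 2)
            = ENNReal.ofReal ((4 * i.2 / r) ^ 2) * ENNReal.ofReal q ^ (2 * (d : ℝ)) := by
          rw [ENNReal.ofReal_rpow_of_pos hq', ← ENNReal.ofReal_mul (by positivity)]
          congr 1
          have : q ^ (2 * (d : ℝ)) = (q ^ d) ^ 2 := by
            rw [← pow_mul, mul_comm d 2, ← Real.rpow_natCast]; push_cast; rfl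
          rw [this]; ring
        calc _ ≤ (ENNReal.ofReal ((4 * (i.2 * q ^ d) / r) ^ 2)) ^ (1 / (2 * (d : ℝ))) := by
              rw [ofReal_homogeneousKernel]
              gcongr
              exact hker d
          _ = _ := by
              rw [e, ENNReal.mul_rpow_of_nonneg _ _ (by positivity), ← ENNReal.rpow_mul,
                mul_one_div_cancel hd', ENNReal.rpow_one]
      refine h1.trans ((limsup_rpow_inv_mul_le ENNReal.ofReal_ne_top
        (fun _ => ENNReal.ofReal q) zero_le_two).trans ?_)
      simp
    exact (hw i.1).not_ge hle
  obtain ⟨F, hF⟩ : ∃ F, ∀ i, F ∉ bad i := by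
    by_contra! hcon
    obtain ⟨i, hi⟩ := nonempty_interior_of_iUnion_of_closed hclosed (Set.iUnion_eq_univ_iff.2 hcon)
    rw [hint i] at hi
    exact Set.not_nonempty_empty hi
  refine ⟨F, fun z => ?_⟩
  have hgood : ∀ i : ι, ENNReal.ofReal i.1.2
      ≤ expansionRadiusFn (basisComponent Q (b.repr F)) (w i) := by
    intro i
    by_contra! hlt
    have hev := eventually_lt_of_limsup_lt hlt
    obtain ⟨N, hN⟩ := eventually_atTop.1 (hev.and (eventually_gt_atTop 0))
    set q : ℝ := ((i.1.2 : ℚ) : ℝ)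
    have hq' : 0 < q := hq i
    -- The sum absorbs the finitely many degrees below `N`; the summand `1` covers the degrees from
    -- `N` on.
    obtain ⟨C, hC⟩ := exists_nat_ge (1 + ∑ d ∈ Finset.range N,
      ‖basisComponentEval Q b d (w i) F‖ / q ^ d)
    have hsum0 : 0 ≤ ∑ d ∈ Finset.range N, ‖basisComponentEval Q b d (w i) F‖ / q ^ d :=
      Finset.sum_nonneg fun d _ => by positivity
    refine hF (i, C) fun d => ?_
    change _ ≤ C * q ^ d
    rcases lt_or_ge d N with hd | hd
    · rw [← div_le_iff₀ (by positivity)]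
      have := Finset.single_le_sum (f := fun d => ‖basisComponentEval Q b d (w i) F‖ / q ^ d)
        (fun d _ => by positivity) (Finset.mem_range.2 hd)
      linarith
    · obtain ⟨h1, h2⟩ := hN d hd
      rw [one_div, ENNReal.rpow_inv_lt_iff (by positivity), ENNReal.rpow_natCast,
        ← ENNReal.ofReal_pow hq'.le, ← ofReal_norm,
        ENNReal.ofReal_lt_ofReal_iff (by positivity)] at h1
      refine h1.le.trans (le_mul_of_one_le_left (by positivity) (by linarith))
  refine le_of_forall_lt fun c hc => ?_
  obtain ⟨q, hq0', hcq, hqu⟩ := ENNReal.lt_iff_exists_rat_btwn.1 hc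
  refine hcq.trans_le (le_limsup_of_frequently_le ?_ (by isBoundedDefault))
  have hfreq : ∃ᶠ y in 𝓝 z, ((Real.toNNReal q : ℝ≥0) : ℝ≥0∞) < bergmanRadiusFn k Q y :=
    frequently_lt_of_lt_limsup (by isBoundedDefault) hqu
  have hq0'' : 0 < q := by
    rcases hq0'.eq_or_lt with h0 | h0
    · rw [← h0] at hcq; simp at hcq
    · exact h0
  rw [frequently_iff]
  intro U hU
  obtain ⟨V, hV, hzV, hVU⟩ := hB.mem_nhds_iff.1 hU
  obtain ⟨y, hyV, hy⟩ := (frequently_iff.1 hfreq) (hB.mem_nhds hV hzV)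
  let i : ι := ⟨(⟨V, hV⟩, q), hq0'', y, hyV, hy⟩
  exact ⟨w i, hVU (hwB i), hgood i⟩

/-- If `h` is the regularized radius function of the Bergman kernel, then it is the regularized
radius function of some square integrable holomorphic function. -/
lemma exists_expansion_of_eq_uscRegularization (hh : IsBalancedGauge h)
    (hQ : ∀ d j, (Q d j).IsHomogeneous d)
    (b : HilbertBasis (Σ d, Fin (k d)) ℂ (bergmanSpace (balancedDomain h)))
    (hb : ∀ d j, (b ⟨d, j⟩ : Lp ℂ 2 ((volume : Measure (Fin n → ℂ)).restrict (balancedDomain h)))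
      =ᵐ[volume.restrict (balancedDomain h)] fun z => MvPolynomial.eval z (Q d j))
    (hu : ∀ z, (h z : ℝ≥0∞) = uscRegularization (bergmanRadiusFn k Q) z) :
    ∃ f ∈ L2Hol (balancedDomain h), ∃ P : ℕ → MvPolynomial (Fin n) ℂ,
      IsHomogeneousExpansion (balancedDomain h) f P ∧
        ∀ z, (h z : ℝ≥0∞) = uscRegularization (expansionRadiusFn P) z := by
  obtain ⟨F, hF⟩ := exists_uscRegularization_bergmanRadiusFn_le (Q := Q) hh.isOpen_balancedDomain b
  refine ⟨bergmanRep F, bergmanRep_mem F, basisComponent Q (b.repr F),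
    isHomogeneousExpansion_basisComponent hh hQ b hb F, fun z => ?_⟩
  rw [hu]
  exact le_antisymm (hF z) (uscRegularization_mono (expansionRadiusFn_basisComponent_le b F) z)

end Implications

theorem mainTheorem2 (n : ℕ) (h : (Fin n → ℂ) → ℝ≥0) (hh : IsBalancedGauge h) :
    (∃ (k : ℕ → ℕ) (Q : (d : ℕ) → Fin (k d) → MvPolynomial (Fin n) ℂ),
      IsHomogeneousOrthonormalBasis (balancedDomain h) k Q) ∧
    ∀ (k : ℕ → ℕ) (Q : (d : ℕ) → Fin (k d) → MvPolynomial (Fin n) ℂ),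
      IsHomogeneousOrthonormalBasis (balancedDomain h) k Q →
      List.TFAE
        [IsDomainOfHolomorphyFor (L2Hol (balancedDomain h)) (balancedDomain h),
          ∃ f ∈ L2Hol (balancedDomain h), ∃ P : ℕ → MvPolynomial (Fin n) ℂ,
            IsHomogeneousExpansion (balancedDomain h) f P ∧
              ∀ z, (h z : ℝ≥0∞) = uscRegularization (expansionRadiusFn P) z,
          ∀ z, (h z : ℝ≥0∞) = uscRegularization (bergmanRadiusFn k Q) z] := by
  refine ⟨hh.exists_isHomogeneousOrthonormalBasis, ?_⟩
  rintro k Q ⟨hQ, b, hb⟩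
  tfae_have 1 → 3 := eq_uscRegularization_bergmanRadiusFn_of_isDomainOfHolomorphyFor hh hQ b hb
  tfae_have 3 → 1 := isDomainOfHolomorphyFor_of_eq_uscRegularization hh b hb
  tfae_have 3 → 2 := exists_expansion_of_eq_uscRegularization hh hQ b hb
  tfae_have 2 → 3 := by
    rintro ⟨f, hf, P, hP, hhP⟩
    exact eq_uscRegularization_bergmanRadiusFn_of_expansion hh hQ b hb hf hP hhP
  tfae_finish
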